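/- **Theorem (odd-covering theorem).** A *$d$-polytope* $P\subset\mathbb{R}^n$ is a union of finitely many *cells*, each the convex hull of a nonempty finite set of points (its vertices), such that every cell has dimension at most $d$, at least one cell has dimension $d$, every nonempty face of a cell is a cell, and any two cells that meet intersect in a cell spanned by some of their common vertices. ($P$ need not be convex, and $d\le n$ is arbitrary.) A *triangulation* $T$ of $P$ is a finite family of simplices with union $P$, closed under taking faces, in which any two simplices are disjoint or meet in a common face; the vertices of $T$ need not be vertices of $P$. Let $P$ be a $d$-polytope with a triangulation $T$, and let $\tau_1,\dots,\tau_m$ be the $d$-simplices of $T$. For every vertex $v$ of $T$ let $A_v$ be the affine span of the minimal cell of $P$ containing $v$, and let $\gamma_v:[0,1]\to A_v$ be a continuous curve with $\gamma_v(0)=v$. Let $H_t:P\to\mathbb{R}^n$ $(t\in[0,1])$ be the homotopy with $H_t(v)=\gamma_v(t)$ for every vertex $v$ of $T$, extended to $P$ simplex by simplex, linearly in the barycentric coordinates of $T$. Then for every $x\in P$ outside a set of $d$-dimensional measure zero: 1. the number of indices $i$ with $x\in H_1(\tau_i)$ is odd; 2. the number of indices $i$ such that $x\in H_1(\tau_i)$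 and $H_1(\tau_i)$ is positively oriented is exactly one more than the number of indices $i$ such that $x\in H_1(\tau_i)$ and $H_1(\tau_i)$ is negatively oriented. Here $H_1$ maps the vertices of $\tau_i$ into the affine span $A$ of $\tau_i$, and $H_1(\tau_i)$ is called positively (negatively) oriented if the affine map $A\to A$ that agrees with $H_1$ on $\tau_i$ has positive (negative) determinant, i.e. if, for an orientation of $A$ and an ordering of the vertices of $\tau_i$ that makes $\tau_i$ positively oriented, the images of the vertices in that order form a positively (negatively) oriented simplex. -/

import Mathlib

open MeasureTheory Set
open scoped unitInterval

/-- A `d`-polytope in `ℝⁿ` with its cell structure: a finite family of nonempty convex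
hulls of finite sets (the cells, each recorded by its finite set of vertices), of dimension at
most `d`, at least one of dimension `d`. Faces of cells are cells, and the intersection of two
cells, unless empty, is a cell spanned by vertices that the two cells have in common.
Neither convexity, connectedness, purity nor `d = n` is required. -/
structure Polytope (d n : ℕ) where
  /-- the vertex sets of the cells -/
  cells : Finset (Finset (EuclideanSpace ℝ (Fin n)))
  nonempty_of_mem : ∀ V ∈ cells, V.Nonempty
  dim_le : ∀ V ∈ cells,
    Module.finrank ℝ (vectorSpan ℝ (V : Set (EuclideanSpace ℝ (Fin n)))) ≤ d
  exists_dim_eq : ∃ V ∈ cells,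
    Module.finrank ℝ (vectorSpan ℝ (V : Set (EuclideanSpace ℝ (Fin n)))) = d
  face_mem : ∀ V ∈ cells, ∀ F : Set (EuclideanSpace ℝ (Fin n)), F.Nonempty →
    IsExposed ℝ (convexHull ℝ (V : Set (EuclideanSpace ℝ (Fin n)))) F →
    ∃ W ∈ cells, convexHull ℝ (W : Set (EuclideanSpace ℝ (Fin n))) = F
  inter_mem : ∀ V ∈ cells, ∀ W ∈ cells,
    (convexHull ℝ (V : Set (EuclideanSpace ℝ (Fin n))) ∩
      convexHull ℝ (W : Set (EuclideanSpace ℝ (Fin n)))).Nonempty →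
    ∃ S ∈ cells, S ⊆ V ∧ S ⊆ W ∧
      convexHull ℝ (S : Set (EuclideanSpace ℝ (Fin n))) =
        convexHull ℝ (V : Set (EuclideanSpace ℝ (Fin n))) ∩
          convexHull ℝ (W : Set (EuclideanSpace ℝ (Fin n)))

namespace Polytope

variable {d n : ℕ}

/-- The underlying point set: the union of the cells. -/
def space (P : Polytope d n) : Set (EuclideanSpace ℝ (Fin n)) :=
  ⋃ V ∈ P.cells, convexHull ℝ (V : Set (EuclideanSpace ℝ (Fin n)))

/-- The minimal cell containing `x`: the intersection of all cells that contain `x`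
(for `x` in the polytope it is itself a cell, see `exists_minimalCell_eq`). -/
def minimalCell (P : Polytope d n) (x : EuclideanSpace ℝ (Fin n)) :
    Set (EuclideanSpace ℝ (Fin n)) :=
  ⋂ V ∈ {V | V ∈ P.cells ∧ x ∈ convexHull ℝ (V : Set (EuclideanSpace ℝ (Fin n)))},
    convexHull ℝ (V : Set (EuclideanSpace ℝ (Fin n)))

theorem exists_minimalCell_eq (P : Polytope d n) {x : EuclideanSpace ℝ (Fin n)}
    (hx : x ∈ P.space) : ∃ V ∈ P.cells, x ∈ convexHull ℝ (V : Set (EuclideanSpace ℝ (Fin n))) ∧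
      convexHull ℝ (V : Set (EuclideanSpace ℝ (Fin n))) = P.minimalCell x := by
  classical
  have key : ∀ D : Finset (Finset (EuclideanSpace ℝ (Fin n))),
      (∀ W ∈ D, W ∈ P.cells ∧ x ∈ convexHull ℝ (W : Set (EuclideanSpace ℝ (Fin n)))) →
      ∃ V ∈ P.cells, x ∈ convexHull ℝ (V : Set (EuclideanSpace ℝ (Fin n))) ∧
        ∀ W ∈ D, convexHull ℝ (V : Set (EuclideanSpace ℝ (Fin n))) ⊆
          convexHull ℝ (W : Set (EuclideanSpace ℝ (Fin n))) := by
    intro D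
    induction D using Finset.induction_on with
    | empty =>
      intro _
      obtain ⟨V, hV, hxV⟩ := mem_iUnion₂.1 hx
      exact ⟨V, hV, hxV, by simp⟩
    | insert W D _ ih =>
      intro h
      obtain ⟨V, hV, hxV, hsub⟩ := ih fun U hU => h U (Finset.mem_insert_of_mem hU)
      obtain ⟨hW, hxW⟩ := h W (Finset.mem_insert_self _ _)
      obtain ⟨S, hS, -, -, hSeq⟩ := P.inter_mem V hV W hW ⟨x, hxV, hxW⟩
      refine ⟨S, hS, by rw [hSeq]; exact ⟨hxV, hxW⟩, fun U hU => ?_⟩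
      rw [hSeq]
      rcases Finset.mem_insert.1 hU with rfl | hU
      · exact inter_subset_right
      · exact inter_subset_left.trans (hsub U hU)
  obtain ⟨V, hV, hxV, hsub⟩ := key
    (P.cells.filter fun W => x ∈ convexHull ℝ (W : Set (EuclideanSpace ℝ (Fin n))))
    (fun W hW => Finset.mem_filter.1 hW)
  refine ⟨V, hV, hxV, Subset.antisymm ?_ ?_⟩
  · exact subset_iInter₂ fun W hW => hsub W (Finset.mem_filter.2 hW)
  · exact iInter₂_subset V ⟨hV, hxV⟩

/-- A triangulation of the polytope: a finite geometric simplicial complex (simplices closed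
under faces, any two meeting in a common face or not at all) whose union is the polytope.
Simplices are recorded by their vertex sets; new vertices are allowed. -/
structure IsTriangulation (P : Polytope d n)
    (T : Geometry.SimplicialComplex ℝ (EuclideanSpace ℝ (Fin n))) : Prop where
  finite : T.faces.Finite
  space_eq : T.space = P.space

end Polytope

namespace Geometry.SimplicialComplex

variable {E : Type*} [AddCommGroup E] [Module ℝ E]

/-- `w` is the family of barycentric coordinates of the point `x` in the complex `T`. -/
def IsBarycentric (T : SimplicialComplex ℝ E) (x : E) (w : E →₀ ℝ) : Prop :=
  w.support ∈ T.faces ∧ (∀ v, 0 ≤ w v) ∧ (w.sum fun _ a => a) = 1 ∧ (w.sum fun v a => a • v) = x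

theorem exists_isBarycentric {T : SimplicialComplex ℝ E} {s : Finset E} (hs : s ∈ T.faces) {x : E}
    (hx : x ∈ convexHull ℝ (s : Set E)) : ∃ w, T.IsBarycentric x w ∧ w.support ⊆ s := by
  classical
  obtain ⟨w, hw0, hw1, hwx⟩ := Finset.mem_convexHull'.1 hx
  let w' : E →₀ ℝ := Finsupp.onFinset s (fun v => if v ∈ s then w v else 0) (by grind)
  have hval : ∀ v, w' v = if v ∈ s then w v else 0 := fun v => rfl
  have hsupp : w'.support ⊆ s := Finsupp.support_onFinset_subset
  have h1 : (w'.sum fun _ a => a) = 1 := by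
    rw [Finsupp.sum_of_support_subset _ hsupp _ (by simp), ← hw1]
    exact Finset.sum_congr rfl fun v hv => by simp [hval, hv]
  refine ⟨w', ⟨T.down_closed hs hsupp ?_, ?_, h1, ?_⟩, hsupp⟩
  · rw [Finset.nonempty_iff_ne_empty]
    intro h
    simp [Finsupp.sum, h] at h1
  · intro v
    rw [hval]
    split_ifs with hv
    exacts [hw0 v hv, le_rfl]
  · rw [Finsupp.sum_of_support_subset _ hsupp _ (by simp), ← hwx]
    exact Finset.sum_congr rfl fun v hv => by simp [hval, hv]

theorem IsBarycentric.unique {T : SimplicialComplex ℝ E} {x : E} {w w' : E →₀ ℝ}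
    (h : T.IsBarycentric x w) (h' : T.IsBarycentric x w') : w = w' := by
  classical
  have mem : ∀ {u : E →₀ ℝ}, T.IsBarycentric x u → x ∈ convexHull ℝ (u.support : Set E) :=
    fun {u} hu => Finset.mem_convexHull'.2 ⟨u, fun v _ => hu.2.1 v, hu.2.2.1, hu.2.2.2⟩
  have aux : ∀ {u z : E →₀ ℝ}, T.IsBarycentric x u → z.support ⊆ u.support →
      (z.sum fun _ a => a) = 1 → (z.sum fun v a => a • v) = x → u = z := by
    intro u z hu hz h1 hx
    have hind := affineIndependent_iff.1 (T.indep hu.1) Finset.univ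
      (fun v => u v - z v) ?_ ?_
    · ext v
      by_cases hv : v ∈ u.support
      · exact sub_eq_zero.1 (hind ⟨v, hv⟩ (Finset.mem_univ _))
      · rw [Finsupp.notMem_support_iff.1 hv, Finsupp.notMem_support_iff.1 fun h => hv (hz h)]
    · rw [Finset.sum_coe_sort u.support (fun v => u v - z v), Finset.sum_sub_distrib]
      rw [Finsupp.sum_of_support_subset _ hz _ (by simp)] at h1
      rw [h1, sub_eq_zero]
      exact hu.2.2.1
    · rw [Finset.sum_coe_sort u.support (fun v => (u v - z v) • v)]
      simp only [sub_smul]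
      rw [Finset.sum_sub_distrib, sub_eq_zero]
      rw [Finsupp.sum_of_support_subset _ hz _ (by simp)] at hx
      rw [hx]
      exact hu.2.2.2
  have hmem : x ∈ convexHull ℝ ((w.support ∩ w'.support : Finset E) : Set E) := by
    rw [Finset.coe_inter]
    exact T.inter_subset_convexHull h.1 h'.1 ⟨mem h, mem h'⟩
  have hne : (w.support ∩ w'.support).Nonempty := by
    have := convexHull_nonempty_iff.1 ⟨x, hmem⟩
    exact_mod_cast this
  obtain ⟨z, hz, hzs⟩ := exists_isBarycentric
    (T.down_closed h.1 Finset.inter_subset_left hne) hmem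
  rw [aux h (hzs.trans Finset.inter_subset_left) hz.2.2.1 hz.2.2.2,
    aux h' (hzs.trans Finset.inter_subset_right) hz.2.2.1 hz.2.2.2]

open Classical in
/-- The barycentric coordinates of `x` in `T` (they exist and are unique for `x ∈ T.space`;
the value is irrelevant elsewhere). -/
noncomputable def barycentric (T : SimplicialComplex ℝ E) (x : E) : E →₀ ℝ :=
  if h : ∃ w, T.IsBarycentric x w then h.choose else 0

theorem IsBarycentric.barycentric_eq {T : SimplicialComplex ℝ E} {x : E} {w : E →₀ ℝ}
    (h : T.IsBarycentric x w) : T.barycentric x = w := by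
  have hex : ∃ w, T.IsBarycentric x w := ⟨w, h⟩
  rw [barycentric, dif_pos hex]
  exact hex.choose_spec.unique h

/-- The homotopy `H t` that moves each vertex `v` of `T` along `γ v`, extended simplex by simplex
linearly in the barycentric coordinates of `T`. -/
noncomputable def vertexHomotopy (T : SimplicialComplex ℝ E) (γ : E → I → E) (t : I) (x : E) : E :=
  (T.barycentric x).sum fun v a => a • γ v t

/-- The image of the simplex with vertex set `τ` under the map `f`, affine on that simplex, is
positively oriented: `f` maps the vertices of `τ` into the affine span `A` of `τ`, and the linear
part `L` of the resulting affine self-map of `A` has positive determinant. Equivalently, for any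
orientation of `A` and any ordering of the vertices of `τ` that makes `τ` positively oriented, the
images of the vertices in that order form a positively oriented nondegenerate simplex of `A`. -/
def ImagePositive (τ : Finset E) (f : E → E) : Prop :=
  (∀ v ∈ τ, f v ∈ affineSpan ℝ (τ : Set E)) ∧
  ∃ L : vectorSpan ℝ (τ : Set E) →ₗ[ℝ] vectorSpan ℝ (τ : Set E),
    (∀ u : vectorSpan ℝ (τ : Set E), ∀ v ∈ τ, ∀ w ∈ τ, (u : E) = v - w → (L u : E) = f v - f w) ∧
      0 < LinearMap.det L

/-- As `ImagePositive`, with negative determinant: the image simplex is negatively oriented. -/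
def ImageNegative (τ : Finset E) (f : E → E) : Prop :=
  (∀ v ∈ τ, f v ∈ affineSpan ℝ (τ : Set E)) ∧
  ∃ L : vectorSpan ℝ (τ : Set E) →ₗ[ℝ] vectorSpan ℝ (τ : Set E),
    (∀ u : vectorSpan ℝ (τ : Set E), ∀ v ∈ τ, ∀ w ∈ τ, (u : E) = v - w → (L u : E) = f v - f w) ∧
      LinearMap.det L < 0

/-- The `d`-simplices `τ` of `T` (as vertex sets) whose image under `f` contains `x`. -/
def covering (T : SimplicialComplex ℝ E) (d : ℕ) (f : E → E) (x : E) : Set (Finset E) :=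
  {τ | τ ∈ T.faces ∧ τ.card = d + 1 ∧ x ∈ f '' convexHull ℝ (τ : Set E)}

end Geometry.SimplicialComplex

/-! Fix a point $x$ of $P$ off every affine span of at most $d$ of the points $v$ and $H_1(v)$, and
off the intersection of any two distinct affine spans of $d$-simplices of $T$; this excludes a null
set. Then $x$ lies in exactly one $d$-simplex $\tau_0$. Each $d$-simplex is mapped into its own
affine span, so every $d$-simplex whose image covers $x$ spans the same affine space $A$ as
$\tau_0$, and by general position its image is nondegenerate. It remains to see that the signed
number of covering images is 1: positive minus negative is 1, hence positive plus negative is odd.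

For the identity the signed number is 1, by the choice of $\tau_0$. The vertices are then moved to
their final positions one at a time. Let $v$ move from $g(v)$ to $u$. The facets of a
$(d+1)$-simplex flattened into $A$ cover a generic point with total sign 0
(`coverSign_eq_sum_update`). Hence the contribution of a simplex $\tau\ni v$ changes by a sum over
the vertices $w\ne v$ of $\tau$, the term of $w$ being the sign of $\tau$ with $w$ sent to $u$. That
image is spanned by $u$ and $g(\rho)$, where $\rho=\tau\setminus w$ contains $v$, so the terms are
grouped by the facet $\rho$.

If the minimal cell of some vertex of $\rho$ leaves the affine span of $\rho$, there is a simplex of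
$T$ on the other side of $\rho$ (`exists_opposite_face`). The two simplices give the same image with
opposite reference orientations, and their terms cancel (`movedSign_insert`). Otherwise $u$ and
$g(\rho)$ lie in the $(d-1)$-dimensional span of $\rho$, and the image is degenerate. This is
`sum_movedSign_update`.

The vanishing of the total sign is one-dimensional: the ways to write $x$ as a combination of $d+2$
points spanning $A$ form a line. Its nonnegative part is empty or a segment whose ends correspond to
the facets containing $x$. At one end an increasing coordinate vanishes, at the other a decreasing
one, and up to sign the velocities of the coordinates are the determinants of the facets. -/

/-! ### Endpoints of the nonnegative part of a line. -/

section SignedCount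

variable {κ : Type*} [Fintype κ]

/-- On the line `s ↦ lam + s • mu`, if the nonnegative part has an endpoint at which an increasing
coordinate vanishes, then it has one at which a decreasing coordinate vanishes. -/
theorem exists_decreasing_endpoint {lam mu : κ → ℝ} (hmu : ∑ k, mu k = 0) {k : κ} (hk : 0 < mu k)
    (h : ∃ s : ℝ, (∀ l, 0 ≤ lam l + s * mu l) ∧ lam k + s * mu k = 0) :
    ∃ k', mu k' < 0 ∧ ∃ s : ℝ, (∀ l, 0 ≤ lam l + s * mu l) ∧ lam k' + s * mu k' = 0 := by
  classical
  obtain ⟨s, hs, -⟩ := h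
  have hne : (Finset.univ.filter fun l => mu l < 0).Nonempty := by
    by_contra hcon
    rw [Finset.not_nonempty_iff_eq_empty, Finset.filter_eq_empty_iff] at hcon
    have : 0 < ∑ k, mu k := Finset.sum_pos' (fun l _ => not_lt.1 (hcon (Finset.mem_univ l)))
      ⟨k, Finset.mem_univ _, hk⟩
    exact this.ne' hmu
  -- The endpoint is the largest parameter at which all decreasing coordinates are still
  -- nonnegative. It is at least `s`, so the increasing coordinates remain nonnegative there.
  obtain ⟨k', hk', hmin⟩ := Finset.exists_min_image _ (fun l => -lam l / mu l) hne
  have hk'0 : mu k' < 0 := (Finset.mem_filter.1 hk').2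
  have hbound : ∀ {t : ℝ} {l : κ}, mu l < 0 → (0 ≤ lam l + t * mu l ↔ t ≤ -lam l / mu l) := by
    intro t l hl
    rw [le_div_iff_of_neg hl]
    constructor <;> intro h <;> linarith
  refine ⟨k', hk'0, -lam k' / mu k', fun l => ?_, ?_⟩
  · rcases lt_or_ge (mu l) 0 with hl | hl
    · exact (hbound hl).2 (hmin l (Finset.mem_filter.2 ⟨Finset.mem_univ _, hl⟩))
    · have h1 := (hbound hk'0).1 (hs k')
      have h2 := mul_le_mul_of_nonneg_right h1 hl
      linarith [hs l]
  · rw [div_mul_cancel₀ _ hk'0.ne, add_neg_cancel]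

open Classical in
/-- The signed number of endpoints of the nonnegative part of a line in general position. -/
theorem sum_sign_endpoint_eq_zero {lam mu : κ → ℝ} (hmu : ∑ k, mu k = 0)
    (hgen : ∀ (s : ℝ) (k l : κ), k ≠ l → lam k + s * mu k = 0 → lam l + s * mu l ≠ 0) :
    ∑ k, ((SignType.sign (mu k) : ℤ) *
      if ∃ s : ℝ, (∀ l, 0 ≤ lam l + s * mu l) ∧ lam k + s * mu k = 0 then 1 else 0) = 0 := by
  set B : κ → Prop := fun k => ∃ s : ℝ, (∀ l, 0 ≤ lam l + s * mu l) ∧ lam k + s * mu k = 0 with hB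
  -- Endpoints whose vanishing coordinates have velocities of the same sign share their parameter,
  -- and general position then identifies the coordinates.
  have hsub : ∀ {k l : κ}, 0 < mu k * mu l → B k → B l → k = l := by
    rintro k l hkl ⟨s, hs, hsk⟩ ⟨t, ht, htl⟩
    by_contra hne
    have h1 := hs l
    have h2 := ht k
    have h3 : s = t := by
      have e1 : 0 ≤ (s - t) * mu l := by linarith
      have e2 : 0 ≤ (t - s) * mu k := by linarith
      have e3 : 0 ≤ -((s - t) * (s - t) * (mu k * mu l)) := by
        have := mul_nonneg e1 e2
        nlinarith
      have e4 : (s - t) * (s - t) = 0 := by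
        by_contra h0
        have : 0 < (s - t) * (s - t) := lt_of_le_of_ne (mul_self_nonneg _) (Ne.symm h0)
        nlinarith [mul_pos this hkl]
      linarith [mul_self_eq_zero.1 e4]
    subst h3
    exact hgen s k l hne hsk htl
  by_cases hpos : ∃ k, 0 < mu k ∧ B k
  · obtain ⟨k, hk, hBk⟩ := hpos
    obtain ⟨k', hk', hBk'⟩ := exists_decreasing_endpoint hmu hk hBk
    have hne : k ≠ k' := by rintro rfl; exact lt_asymm hk hk'
    rw [← Finset.sum_subset (Finset.subset_univ {k, k'})]
    · rw [Finset.sum_pair hne, if_pos hBk, if_pos hBk', sign_pos hk, sign_neg hk']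
      simp
    · intro l _ hl
      rw [Finset.mem_insert, Finset.mem_singleton, not_or] at hl
      by_cases hBl : B l
      · rcases lt_trichotomy (mu l) 0 with h | h | h
        · exact absurd (hsub (mul_pos_of_neg_of_neg h hk') hBl hBk') hl.2
        · simp [h]
        · exact absurd (hsub (mul_pos h hk) hBl hBk) hl.1
      · rw [if_neg hBl, mul_zero]
  · have hneg : ¬ ∃ k, mu k < 0 ∧ B k := by
      rintro ⟨k, hk, s, hs, hsk⟩
      -- Reversing the direction of the line exchanges increasing and decreasing endpoints.
      obtain ⟨k', hk', t, ht, htk⟩ := exists_decreasing_endpoint (lam := lam) (mu := -mu) (k := k)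
        (by simpa using hmu) (by simpa using hk)
        ⟨-s, fun l => by simpa using hs l, by simpa using hsk⟩
      exact hpos ⟨k', by simpa using hk', -t, fun l => by simpa using ht l, by simpa using htk⟩
    refine Finset.sum_eq_zero fun k _ => ?_
    by_cases hBk : B k
    · rcases lt_trichotomy (mu k) 0 with h | h | h
      · exact absurd ⟨k, h, hBk⟩ hneg
      · simp [h]
      · exact absurd ⟨k, h, hBk⟩ hpos
    · rw [if_neg hBk, mul_zero]

end SignedCount

/-! ### Signed cones spanned by all but one of `m + 1` vectors. -/

section ConeSign

variable {m : ℕ}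

open Classical in
/-- The sign of the determinant of `p` if the cone spanned by `p` contains `Y`, else `0`. -/
noncomputable def coneSign (p : Fin m → Fin m → ℝ) (Y : Fin m → ℝ) : ℤ :=
  (SignType.sign (Matrix.det (Matrix.of p)) : ℤ) *
    if ∃ c : Fin m → ℝ, (∀ i, 0 ≤ c i) ∧ ∑ i, c i • p i = Y then 1 else 0

/-- Cramer's rule. It is the linear relation between `q` and the `p j` whose coefficients are, up to
sign, the determinants of the cones to be compared. -/
theorem sum_det_update_smul (p : Fin m → Fin m → ℝ) (q : Fin m → ℝ) :
    ∑ j, Matrix.det (Matrix.of (Function.update p j q)) • p j = Matrix.det (Matrix.of p) • q := by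
  have h := Matrix.mulVec_cramer (Matrix.of p).transpose q
  rw [Matrix.det_transpose] at h
  rw [← h]
  ext i
  simp only [Finset.sum_apply, Pi.smul_apply, smul_eq_mul, Matrix.mulVec, dotProduct,
    Matrix.transpose_apply, Matrix.of_apply, Matrix.cramer_transpose_apply]
  exact Finset.sum_congr rfl fun j _ => mul_comm _ _

theorem eq_zero_of_sum_smul_eq_zero {p : Fin m → Fin m → ℝ} (hp : Matrix.det (Matrix.of p) ≠ 0)
    {c : Fin m → ℝ} (hc : ∑ i, c i • p i = 0) : c = 0 := by
  refine Matrix.eq_zero_of_vecMul_eq_zero hp ?_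
  rw [← hc]
  ext j
  simp [Matrix.vecMul, dotProduct]

theorem exists_sum_smul_eq {p : Fin m → Fin m → ℝ} (hp : Matrix.det (Matrix.of p) ≠ 0)
    (Y : Fin m → ℝ) : ∃ c : Fin m → ℝ, ∑ i, c i • p i = Y := by
  refine ⟨fun j => (Matrix.det (Matrix.of p))⁻¹ * Matrix.det (Matrix.of (Function.update p j Y)), ?_⟩
  have := congrArg (fun z => (Matrix.det (Matrix.of p))⁻¹ • z) (sum_det_update_smul p Y)
  simpa [Finset.smul_sum, smul_smul, hp] using this

/-- The coefficients of a combination of `Function.update p j q`, as coefficients over `p` and the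
additional vector `q`. -/
noncomputable def liftCoeff : Option (Fin m) → (Fin m → ℝ) → Option (Fin m) → ℝ
  | none, c => fun k => k.elim 0 c
  | some j, c => fun k => k.elim (c j) (Function.update c j 0)

/-- The family `p`, or `p` with the entry `j` replaced by `q`. -/
noncomputable def replaceOne (p : Fin m → Fin m → ℝ) (q : Fin m → ℝ) :
    Option (Fin m) → Fin m → Fin m → ℝ
  | none => p
  | some j => Function.update p j q

theorem liftCoeff_self (k : Option (Fin m)) (c : Fin m → ℝ) : liftCoeff k c k = 0 := by
  cases k <;> simp [liftCoeff]

theorem liftCoeff_nonneg (k : Option (Fin m)) {c : Fin m → ℝ} (hc : ∀ i, 0 ≤ c i)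
    (l : Option (Fin m)) : 0 ≤ liftCoeff k c l := by
  cases k with
  | none => cases l <;> simp [liftCoeff, hc]
  | some j =>
    cases l with
    | none => simp [liftCoeff, hc]
    | some i =>
      by_cases h : i = j
      · subst h; simp [liftCoeff]
      · simp [liftCoeff, h, hc]

/-- Inverse of `liftCoeff k`: when the coefficient of `k = some j` vanishes, slot `j` is free to
carry the coefficient of `q`. -/
theorem exists_liftCoeff_eq (k : Option (Fin m)) {a : Option (Fin m) → ℝ} (ha : a k = 0) :
    ∃ c, liftCoeff k c = a ∧ ((∀ l, 0 ≤ a l) → ∀ i, 0 ≤ c i) := by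
  cases k with
  | none =>
    refine ⟨fun i => a (some i), ?_, fun h i => h _⟩
    ext l
    cases l <;> simp [liftCoeff, ha]
  | some j =>
    refine ⟨Function.update (fun i => a (some i)) j (a none), ?_, fun h i => ?_⟩
    · ext l
      cases l with
      | none => simp [liftCoeff]
      | some i =>
        by_cases h : i = j
        · subst h; simp [liftCoeff, ha]
        · simp [liftCoeff, h]
    · by_cases hi : i = j
      · subst hi; simpa using h none
      · simpa [hi] using h (some i)

theorem sum_liftCoeff_smul (p : Fin m → Fin m → ℝ) (q : Fin m → ℝ) (k : Option (Fin m))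
    (c : Fin m → ℝ) :
    ∑ l, liftCoeff k c l • l.elim q p = ∑ i, c i • replaceOne p q k i := by
  rw [Fintype.sum_option]
  cases k with
  | none => simp [liftCoeff, replaceOne]
  | some j =>
    simp only [liftCoeff, replaceOne, Option.elim]
    rw [← Finset.add_sum_erase _ _ (Finset.mem_univ j),
      ← Finset.add_sum_erase (a := j) Finset.univ (fun i => c i • Function.update p j q i)
        (Finset.mem_univ j)]
    simp only [Function.update_self, zero_smul, zero_add]
    congr 1
    refine Finset.sum_congr rfl fun i hi => ?_
    rw [Function.update_of_ne (Finset.ne_of_mem_erase hi),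
      Function.update_of_ne (Finset.ne_of_mem_erase hi)]

/-- Unless all determinants vanish, the representations of `Y` by `q` and the `p i` form a line with
direction `mu`, the relation given by Cramer's rule. Applying `L` to that relation gives `∑ mu = 0`.
An endpoint where coordinate `k` vanishes is a nonnegative representation over `replaceOne p q k`,
so the signed count of endpoints is the asserted identity; the minus sign of `mu none` moves
`coneSign p Y` to the other side. -/
theorem coneSign_eq_sum_update {p : Fin m → Fin m → ℝ} {q Y : Fin m → ℝ}
    (L : (Fin m → ℝ) →ₗ[ℝ] ℝ) (hp : ∀ i, L (p i) = 1) (hq : L q = 1)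
    (hgen : ∀ (c : Option (Fin m) → ℝ) (k l : Option (Fin m)), k ≠ l → c k = 0 → c l = 0 →
      ∑ i, c i • i.elim q p ≠ Y) :
    coneSign p Y = ∑ j, coneSign (Function.update p j q) Y := by
  classical
  set D : Option (Fin m) → ℝ := fun k => Matrix.det (Matrix.of (replaceOne p q k)) with hD
  set mu : Option (Fin m) → ℝ := fun k => k.elim (-D none) (fun j => D (some j)) with hmu
  set r : Option (Fin m) → Fin m → ℝ := fun k => k.elim q p with hr
  have hrel : ∑ k, mu k • r k = 0 := by
    rw [Fintype.sum_option]
    have := sum_det_update_smul p q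
    simp only [hmu, hr, hD, Option.elim, replaceOne]
    rw [this]
    simp
  have hmu0 : ∑ k, mu k = 0 := by
    have := congrArg L hrel
    rw [map_sum, map_zero] at this
    rw [← this]
    refine Finset.sum_congr rfl fun k _ => ?_
    rw [map_smul, smul_eq_mul]
    cases k <;> simp [hr, hp, hq]
  have hDmu : ∀ {k}, mu k ≠ 0 → D k ≠ 0 := by
    intro k hk
    cases k with
    | none => simpa [hmu] using hk
    | some j => simpa [hmu] using hk
  by_cases hall : ∀ k, mu k = 0
  · have h0 : ∀ k, D k = 0 := by
      intro k
      cases k with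
      | none => simpa [hmu] using hall none
      | some j => simpa [hmu] using hall (some j)
    have h1 : ∀ k, coneSign (replaceOne p q k) Y = 0 := by
      intro k
      have := h0 k
      simp only [hD] at this
      simp [coneSign, this]
    rw [show coneSign p Y = 0 from h1 none]
    exact (Finset.sum_eq_zero fun j _ => h1 (some j)).symm
  push Not at hall
  obtain ⟨k₀, hk₀⟩ := hall
  obtain ⟨c₀, hc₀⟩ := exists_sum_smul_eq (hDmu hk₀) Y
  set lam := liftCoeff k₀ c₀ with hlam
  have hlamY : ∑ k, lam k • r k = Y := by rw [hlam, sum_liftCoeff_smul, hc₀]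
  have hline : ∀ s : ℝ, ∑ k, (lam k + s * mu k) • r k = Y := by
    intro s
    simp only [add_smul, mul_smul, Finset.sum_add_distrib, ← Finset.smul_sum]
    rw [hlamY, hrel]
    simp
  have key := sum_sign_endpoint_eq_zero (lam := lam) hmu0 fun s k l hkl hk hl =>
    hgen (fun k => lam k + s * mu k) k l hkl hk hl (hline s)
  have hterm : ∀ k, (SignType.sign (mu k) : ℤ) *
      (if ∃ s : ℝ, (∀ l, 0 ≤ lam l + s * mu l) ∧ lam k + s * mu k = 0 then 1 else 0) =
      (SignType.sign (mu k) : ℤ) * (if ∃ c : Fin m → ℝ, (∀ i, 0 ≤ c i) ∧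
        ∑ i, c i • replaceOne p q k i = Y then 1 else 0) := by
    intro k
    by_cases hk : mu k = 0
    · simp [hk]
    congr 1
    refine if_congr ⟨?_, ?_⟩ rfl rfl
    · rintro ⟨s, hs, hsk⟩
      obtain ⟨c, hc, hc0⟩ := exists_liftCoeff_eq k (a := fun l => lam l + s * mu l) hsk
      refine ⟨c, hc0 hs, ?_⟩
      rw [← sum_liftCoeff_smul, hc, ← hline s]
    · rintro ⟨c, hc0, hc⟩
      -- The vanishing of coordinate `k` forces the parameter. As `D k ≠ 0`, only one representation
      -- has zero coefficient at `k`, so the given one is this point of the line.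
      refine ⟨-lam k / mu k, ?_⟩
      have hz : lam k + -lam k / mu k * mu k = 0 := by field_simp; ring
      obtain ⟨c', hc', -⟩ := exists_liftCoeff_eq k
        (a := fun l => liftCoeff k c l - (lam l + -lam k / mu k * mu l))
        (by rw [liftCoeff_self, hz, sub_zero])
      have hzero : c' = 0 := by
        refine eq_zero_of_sum_smul_eq_zero (hDmu hk) ?_
        rw [← sum_liftCoeff_smul, hc']
        change ∑ l, (liftCoeff k c l - (lam l + -lam k / mu k * mu l)) • r l = 0
        rw [Finset.sum_congr rfl fun l _ => sub_smul _ _ (r l), Finset.sum_sub_distrib, hline,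
          sum_liftCoeff_smul, hc, sub_self]
      have hl0 : ∀ l, liftCoeff k c l = lam l + -lam k / mu k * mu l := by
        intro l
        have := congrFun hc' l
        rw [hzero] at this
        have h0 : liftCoeff k (0 : Fin m → ℝ) l = 0 := by
          cases k <;> cases l <;> simp [liftCoeff]
        rw [h0] at this
        linarith
      exact ⟨fun l => hl0 l ▸ liftCoeff_nonneg k hc0 l, hz⟩
  rw [Finset.sum_congr rfl fun k _ => hterm k, Fintype.sum_option] at key
  have hnone : (SignType.sign (mu none) : ℤ) = -(SignType.sign (D none) : ℤ) := by
    simp [hmu, Left.sign_neg]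
  rw [hnone, neg_mul, neg_add_eq_zero] at key
  exact key

end ConeSign

/-! ### Orderings of the vertices of a simplex. -/

section Enumeration

variable {d : ℕ} {E : Type*}

theorem exists_perm_of_range_eq {κ : Type*} {e e' : κ → E} (he : Function.Injective e)
    (he' : Function.Injective e') (h : range e = range e') :
    ∃ π : Equiv.Perm κ, e' = e ∘ π := by
  refine ⟨(Equiv.ofInjective e' he').trans ((Equiv.setCongr h.symm).trans
    (Equiv.ofInjective e he).symm), funext fun i => ?_⟩
  simp [Equiv.apply_ofInjective_symm]

theorem exists_enumeration {τ : Finset E} (hτ : τ.card = d + 1) :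
    ∃ e : Fin (d + 1) → E, Function.Injective e ∧ range e = (τ : Set E) := by
  refine ⟨fun i => ((τ.equivFinOfCardEq hτ).symm i : E),
    Subtype.val_injective.comp (Equiv.injective _), ?_⟩
  ext x
  constructor
  · rintro ⟨i, rfl⟩
    exact ((τ.equivFinOfCardEq hτ).symm i).2
  · exact fun hx => ⟨τ.equivFinOfCardEq hτ ⟨x, hx⟩, by simp⟩

theorem card_of_enumeration {τ : Finset E} {e : Fin (d + 1) → E} (he : Function.Injective e)
    (hr : range e = (τ : Set E)) : τ.card = d + 1 := by
  classical
  have : τ = Finset.univ.image e := by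
    apply Finset.coe_injective
    rw [Finset.coe_image, Finset.coe_univ, image_univ, hr]
  rw [this, Finset.card_image_of_injective _ he, Finset.card_fin]

theorem update_comp_of_injective [DecidableEq E] {e : Fin (d + 1) → E} (he : Function.Injective e)
    (g : E → E) (j : Fin (d + 1)) (u : E) :
    Function.update g (e j) u ∘ e = Function.update (g ∘ e) j u :=
  Function.update_comp_eq_of_injective g he j u

end Enumeration

/-! ### Homogeneous coordinates, general position and covering signs. -/

section AffineCoordinates

variable {d : ℕ} {E : Type*} [AddCommGroup E] [Module ℝ E]

theorem AffineSubspace.sum_smul_mem {κ : Type*} {S : AffineSubspace ℝ E} {s : Finset κ} {c : κ → ℝ}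
    {x : κ → E} (hc : ∑ i ∈ s, c i = 1) (hx : ∀ i ∈ s, x i ∈ S) : ∑ i ∈ s, c i • x i ∈ S := by
  obtain ⟨i₀, hi₀⟩ : s.Nonempty := by
    rw [Finset.nonempty_iff_ne_empty]
    rintro rfl
    simp at hc
  have : ∑ i ∈ s, c i • x i = ∑ i ∈ s, c i • (x i - x i₀) + x i₀ := by
    simp only [smul_sub, Finset.sum_sub_distrib, ← Finset.sum_smul, hc, one_smul, sub_add_cancel]
  rw [this]
  exact AffineSubspace.vadd_mem_of_mem_direction (Submodule.sum_mem _ fun i hi =>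
    Submodule.smul_mem _ _ (AffineSubspace.vsub_mem_direction (hx i hi) (hx i₀ hi₀))) (hx i₀ hi₀)

theorem mem_convexHull_range_iff {κ : Type*} [Fintype κ] {g : κ → E} {y : E} :
    y ∈ convexHull ℝ (range g) ↔
      ∃ c : κ → ℝ, (∀ i, 0 ≤ c i) ∧ ∑ i, c i = 1 ∧ ∑ i, c i • g i = y := by
  constructor
  · intro h
    rw [convexHull_range_eq_exists_affineCombination] at h
    obtain ⟨s, w, hw0, hw1, rfl⟩ := h
    classical
    refine ⟨fun i => if i ∈ s then w i else 0, fun i => ?_, ?_, ?_⟩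
    · by_cases hi : i ∈ s
      · simpa [hi] using hw0 i hi
      · simp [hi]
    · simpa using hw1
    · rw [Finset.affineCombination_eq_linear_combination _ _ _ hw1]
      simp [ite_smul]
  · rintro ⟨c, hc0, hc1, rfl⟩
    exact (convex_convexHull ℝ _).sum_mem (fun i _ => hc0 i) hc1
      fun i _ => subset_convexHull ℝ _ (mem_range_self i)

/-- Homogeneous coordinates of a point, read off a linear map to `ℝᵈ`. -/
def homogCoord (Φ : E →ₗ[ℝ] (Fin d → ℝ)) (p : E) : Fin (d + 1) → ℝ := Fin.cons 1 (Φ p)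

theorem sum_smul_homogCoord {κ : Type*} (Φ : E →ₗ[ℝ] (Fin d → ℝ)) (s : Finset κ) (c : κ → ℝ)
    (x : κ → E) : ∑ i ∈ s, c i • homogCoord Φ (x i) =
      (Fin.cons (∑ i ∈ s, c i) (Φ (∑ i ∈ s, c i • x i)) : Fin (d + 1) → ℝ) := by
  ext j
  refine Fin.cases ?_ (fun j => ?_) j
  · simp [homogCoord]
  · simp [homogCoord, map_sum]

theorem sum_smul_homogCoord_eq_homogCoord {κ : Type*} (Φ : E →ₗ[ℝ] (Fin d → ℝ)) {s : Finset κ}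
    {c : κ → ℝ} {x : κ → E} (hc : ∑ i ∈ s, c i = 1) :
    ∑ i ∈ s, c i • homogCoord Φ (x i) = homogCoord Φ (∑ i ∈ s, c i • x i) := by
  rw [sum_smul_homogCoord, hc, homogCoord]

/-- The leading coordinate 1 records the sum of the coefficients, and `Φ` is injective on the
direction of `A`. Convex hulls in `A` thereby become cones in `ℝ^(d+1)`. -/
theorem sum_smul_homogCoord_eq_iff {κ : Type*} {Φ : E →ₗ[ℝ] (Fin d → ℝ)} {A : AffineSubspace ℝ E}
    (hΦ : ∀ v ∈ A.direction, Φ v = 0 → v = 0) {s : Finset κ} {c : κ → ℝ} {x : κ → E}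
    (hx : ∀ i ∈ s, x i ∈ A) {y : E} (hy : y ∈ A) :
    ∑ i ∈ s, c i • homogCoord Φ (x i) = homogCoord Φ y ↔
      ∑ i ∈ s, c i = 1 ∧ ∑ i ∈ s, c i • x i = y := by
  constructor
  · intro h
    rw [sum_smul_homogCoord, homogCoord, Fin.cons_inj] at h
    refine ⟨h.1, sub_eq_zero.1 (hΦ _ ?_ ?_)⟩
    · exact AffineSubspace.vsub_mem_direction (AffineSubspace.sum_smul_mem h.1 hx) hy
    · rw [map_sub, h.2, sub_self]
  · rintro ⟨h1, rfl⟩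
    exact sum_smul_homogCoord_eq_homogCoord Φ h1

theorem sum_smul_mem_direction {κ : Type*} {A : AffineSubspace ℝ E} {s : Finset κ} {c : κ → ℝ}
    {x : κ → E} (hx : ∀ i ∈ s, x i ∈ A) (hc : ∑ i ∈ s, c i = 0) :
    ∑ i ∈ s, c i • x i ∈ A.direction := by
  rcases s.eq_empty_or_nonempty with rfl | ⟨i₀, hi₀⟩
  · simp
  have : ∑ i ∈ s, c i • x i = ∑ i ∈ s, c i • (x i - x i₀) := by
    simp only [smul_sub, Finset.sum_sub_distrib, ← Finset.sum_smul, hc, zero_smul, sub_zero]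
  rw [this]
  exact Submodule.sum_mem _ fun i hi => Submodule.smul_mem _ _
    (AffineSubspace.vsub_mem_direction (hx i hi) (hx i₀ hi₀))

/-- The determinant of the homogeneous coordinates of a `(d + 1)`-tuple of points. -/
noncomputable def simplexDet (Φ : E →ₗ[ℝ] (Fin d → ℝ)) (g : Fin (d + 1) → E) : ℝ :=
  Matrix.det (Matrix.of fun i => homogCoord Φ (g i))

/-- The linear dependence of homogeneous coordinates behind a vanishing determinant. -/
theorem exists_affine_dependence {Φ : E →ₗ[ℝ] (Fin d → ℝ)} {A : AffineSubspace ℝ E}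
    (hΦ : ∀ v ∈ A.direction, Φ v = 0 → v = 0) {g : Fin (d + 1) → E} (hg : ∀ i, g i ∈ A)
    (h : simplexDet Φ g = 0) :
    ∃ c : Fin (d + 1) → ℝ, c ≠ 0 ∧ ∑ i, c i = 0 ∧ ∑ i, c i • g i = 0 := by
  obtain ⟨c, hc, hc0⟩ := Matrix.exists_vecMul_eq_zero_iff.2 h
  have h1 : ∑ i, c i • homogCoord Φ (g i) = 0 := by
    rw [← hc0]
    ext j
    simp [Matrix.vecMul, dotProduct]
  rw [sum_smul_homogCoord] at h1
  have h2 : ∑ i, c i = 0 := by simpa using congrFun h1 0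
  refine ⟨c, hc, h2, hΦ _ (sum_smul_mem_direction (fun i _ => hg i) h2) ?_⟩
  ext j
  simpa using congrFun h1 j.succ

theorem simplexDet_ne_zero {Φ : E →ₗ[ℝ] (Fin d → ℝ)} {A : AffineSubspace ℝ E}
    (hΦ : ∀ v ∈ A.direction, Φ v = 0 → v = 0) {g : Fin (d + 1) → E} (hg : ∀ i, g i ∈ A)
    (hind : AffineIndependent ℝ g) : simplexDet Φ g ≠ 0 := by
  intro h
  obtain ⟨c, hc, hc0, hcg⟩ := exists_affine_dependence hΦ hg h
  exact hc (funext fun i => affineIndependent_iff.1 hind Finset.univ c hc0 hcg i (Finset.mem_univ _))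

theorem affineIndependent_of_simplexDet_ne_zero {Φ : E →ₗ[ℝ] (Fin d → ℝ)} {g : Fin (d + 1) → E}
    (h : simplexDet Φ g ≠ 0) : AffineIndependent ℝ g := by
  rw [affineIndependent_iff_of_fintype]
  intro w hw hw0 i
  rw [Finset.weightedVSub_eq_linear_combination _ hw] at hw0
  have := eq_zero_of_sum_smul_eq_zero (p := fun i => homogCoord Φ (g i)) h (c := w) (by
    rw [sum_smul_homogCoord, hw, hw0, map_zero]
    ext j
    refine Fin.cases ?_ (fun j => ?_) j <;> simp)
  exact congrFun this i

/-- By multilinearity only the summand `c j • e j` contributes: a barycentric coordinate is a ratio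
of determinants. -/
theorem simplexDet_update_sum (Φ : E →ₗ[ℝ] (Fin d → ℝ)) (e : Fin (d + 1) → E) (j : Fin (d + 1))
    {c : Fin (d + 1) → ℝ} (hc : ∑ i, c i = 1) :
    simplexDet Φ (Function.update e j (∑ i, c i • e i)) = c j * simplexDet Φ e := by
  have h := Matrix.det_updateRow_sum (Matrix.of fun i => homogCoord Φ (e i)) j c
  rw [smul_eq_mul] at h
  rw [simplexDet, simplexDet, ← h]
  congr 1
  ext i k
  rcases eq_or_ne i j with rfl | hij
  · simp [Matrix.updateRow_self, ← sum_smul_homogCoord_eq_homogCoord Φ hc]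
  · simp [Matrix.updateRow_ne, hij]

theorem simplexDet_comp_perm (Φ : E →ₗ[ℝ] (Fin d → ℝ)) (e : Fin (d + 1) → E)
    (π : Equiv.Perm (Fin (d + 1))) :
    simplexDet Φ (e ∘ π) = (Equiv.Perm.sign π : ℝ) * simplexDet Φ e :=
  Matrix.det_permute π (Matrix.of fun i => homogCoord Φ (e i))

/-- `y` lies on no affine span of at most `d` points of `Q`. -/
def InGeneralPosition (d : ℕ) (Q : Set E) (y : E) : Prop :=
  ∀ S : Finset E, (S : Set E) ⊆ Q → S.card ≤ d → y ∉ affineSpan ℝ (S : Set E)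

theorem InGeneralPosition.sum_smul_ne {κ : Type*} {Q : Set E} {y : E}
    (hy : InGeneralPosition d Q y) {x : κ → E} (hx : ∀ i, x i ∈ Q) {s : Finset κ} (hs : s.card ≤ d)
    {c : κ → ℝ} (hc : ∑ i ∈ s, c i = 1) : ∑ i ∈ s, c i • x i ≠ y := by
  classical
  rintro rfl
  refine hy (s.image x) ?_ (Finset.card_image_le.trans hs) (AffineSubspace.sum_smul_mem hc ?_)
  · intro z hz
    obtain ⟨i, -, rfl⟩ := Finset.mem_image.1 (Finset.mem_coe.1 hz)
    exact hx i
  · exact fun i hi => subset_affineSpan ℝ _ (Finset.mem_coe.2 (Finset.mem_image_of_mem x hi))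

/-- If the points were dependent, a multiple of the dependence could be subtracted from the
coefficients of `y` to remove one point, which would place `y` in the affine span of `d` points of
`Q`. -/
theorem simplexDet_ne_zero_of_mem_convexHull {Q : Set E} {y : E} (hy : InGeneralPosition d Q y)
    {Φ : E →ₗ[ℝ] (Fin d → ℝ)} {A : AffineSubspace ℝ E}
    (hΦ : ∀ v ∈ A.direction, Φ v = 0 → v = 0) {g : Fin (d + 1) → E} (hg : ∀ i, g i ∈ A)
    (hgQ : ∀ i, g i ∈ Q) (hyg : y ∈ convexHull ℝ (range g)) : simplexDet Φ g ≠ 0 := by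
  intro h
  obtain ⟨a, ha, ha0, hag⟩ := exists_affine_dependence hΦ hg h
  obtain ⟨c, -, hc1, hcg⟩ := mem_convexHull_range_iff.1 hyg
  obtain ⟨i, hi⟩ := Function.ne_iff.1 ha
  rw [Pi.zero_apply] at hi
  have hz : c i - c i / a i * a i = 0 := by rw [div_mul_cancel₀ _ hi, sub_self]
  refine hy.sum_smul_ne hgQ (s := Finset.univ.erase i) (by simp)
    (c := fun k => c k - c i / a i * a k) ?_ ?_
  · rw [Finset.sum_erase (f := fun k => c k - c i / a i * a k) _ hz, Finset.sum_sub_distrib, ← Finset.mul_sum, ha0, hc1]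
    simp
  · rw [Finset.sum_erase _ (by rw [hz, zero_smul])]
    simp only [sub_smul, mul_smul, Finset.sum_sub_distrib, ← Finset.smul_sum, hag, hcg]
    simp

open Classical in
/-- The orientation sign of the tuple `g` if its convex hull contains `y`, else `0`. -/
noncomputable def coverSign (Φ : E →ₗ[ℝ] (Fin d → ℝ)) (y : E) (g : Fin (d + 1) → E) : ℤ :=
  (SignType.sign (simplexDet Φ g) : ℤ) * if y ∈ convexHull ℝ (range g) then 1 else 0

theorem coverSign_eq_coneSign {Φ : E →ₗ[ℝ] (Fin d → ℝ)} {A : AffineSubspace ℝ E}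
    (hΦ : ∀ v ∈ A.direction, Φ v = 0 → v = 0) {g : Fin (d + 1) → E} (hg : ∀ i, g i ∈ A) {y : E}
    (hy : y ∈ A) : coverSign Φ y g = coneSign (fun i => homogCoord Φ (g i)) (homogCoord Φ y) := by
  classical
  unfold coverSign coneSign simplexDet
  congr 1
  refine if_congr ?_ rfl rfl
  simp_rw [mem_convexHull_range_iff, sum_smul_homogCoord_eq_iff hΦ (fun i _ => hg i) hy]

/-- The boundary of a flattened `(d + 1)`-simplex covers `y` with total sign 0. Two vanishing
coefficients among `d + 2` points would leave `y` in the span of `d` points of `Q`, so general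
position is the genericity needed by `coneSign_eq_sum_update`. -/
theorem coverSign_eq_sum_update {Q : Set E} {y : E} (hyQ : InGeneralPosition d Q y)
    {Φ : E →ₗ[ℝ] (Fin d → ℝ)} {A : AffineSubspace ℝ E}
    (hΦ : ∀ v ∈ A.direction, Φ v = 0 → v = 0) (hy : y ∈ A) {g : Fin (d + 1) → E}
    (hg : ∀ i, g i ∈ A) (hgQ : ∀ i, g i ∈ Q) {q : E} (hq : q ∈ A) (hqQ : q ∈ Q) :
    coverSign Φ y g = ∑ j, coverSign Φ y (Function.update g j q) := by
  classical
  have hupd : ∀ j i, Function.update g j q i ∈ A := fun j i => by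
    rcases eq_or_ne i j with rfl | h
    · simpa using hq
    · simpa [h] using hg i
  rw [coverSign_eq_coneSign hΦ hg hy, coneSign_eq_sum_update (q := homogCoord Φ q)
    (LinearMap.proj 0) (by simp [homogCoord]) (by simp [homogCoord])]
  · refine Finset.sum_congr rfl fun j _ => ?_
    rw [coverSign_eq_coneSign hΦ (hupd j) hy]
    congr 1
    ext i k
    rcases eq_or_ne i j with rfl | h
    · simp
    · simp [h]
  · intro c k l hkl hk hl h
    have h' : ∑ i, c i • homogCoord Φ (i.elim q g) = homogCoord Φ y := by
      rw [← h]
      exact Finset.sum_congr rfl fun i _ => by cases i <;> rfl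
    rw [sum_smul_homogCoord_eq_iff hΦ (fun i _ => by cases i <;> simp [hq, hg]) hy] at h'
    refine hyQ.sum_smul_ne (x := fun i : Option (Fin (d + 1)) => i.elim q g)
      (s := (Finset.univ.erase k).erase l) (c := c) (fun i => by cases i <;> simp [hqQ, hgQ])
      ?_ ?_ ?_
    · rw [Finset.card_erase_of_mem (Finset.mem_erase.2 ⟨hkl.symm, Finset.mem_univ _⟩),
        Finset.card_erase_of_mem (Finset.mem_univ _)]
      simp
    · rw [Finset.sum_erase _ hl, Finset.sum_erase _ hk, h'.1]
    · rw [Finset.sum_erase _ (by rw [hl, zero_smul]), Finset.sum_erase _ (by rw [hk, zero_smul])]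
      exact h'.2

theorem coverSign_comp_perm (Φ : E →ₗ[ℝ] (Fin d → ℝ)) (y : E) (g : Fin (d + 1) → E)
    (π : Equiv.Perm (Fin (d + 1))) :
    coverSign Φ y (g ∘ π) = (Equiv.Perm.sign π : ℤ) * coverSign Φ y g := by
  have hr : range (g ∘ π) = range g := π.surjective.range_comp g
  unfold coverSign
  rw [simplexDet_comp_perm, hr, ← mul_assoc]
  congr 1
  rcases Int.units_eq_one_or (Equiv.Perm.sign π) with h | h <;> simp [h, Left.sign_neg]

/-- The contribution of the simplex with vertex set `τ`, moved by `g`, to the signed number of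
simplices covering `y`: orientations are compared before and after the move. -/
noncomputable def movedSign (Φ : E →ₗ[ℝ] (Fin d → ℝ)) (y : E) (τ : Finset E) (g : E → E) : ℤ :=
  if h : τ.card = d + 1 then
    (SignType.sign (simplexDet Φ fun i => ((τ.equivFinOfCardEq h).symm i : E)) : ℤ) *
      coverSign Φ y fun i => g ((τ.equivFinOfCardEq h).symm i)
  else 0

/-- A reordering of the vertices changes the orientation before and after the move by the same sign,
so the product does not depend on the ordering. -/
theorem movedSign_eq (Φ : E →ₗ[ℝ] (Fin d → ℝ)) (y : E) {τ : Finset E} (g : E → E)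
    {e : Fin (d + 1) → E} (he : Function.Injective e) (hr : range e = (τ : Set E)) :
    movedSign Φ y τ g = (SignType.sign (simplexDet Φ e) : ℤ) * coverSign Φ y (g ∘ e) := by
  have hcard := card_of_enumeration he hr
  have hinj : Function.Injective fun i => ((τ.equivFinOfCardEq hcard).symm i : E) :=
    Subtype.val_injective.comp (Equiv.injective _)
  obtain ⟨π, hπ⟩ := exists_perm_of_range_eq he hinj (by
    rw [hr]
    ext x
    exact ⟨fun hx => ⟨τ.equivFinOfCardEq hcard ⟨x, hx⟩, by simp⟩,
      by rintro ⟨i, rfl⟩; exact ((τ.equivFinOfCardEq hcard).symm i).2⟩)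
  rw [movedSign, dif_pos hcard, hπ, simplexDet_comp_perm]
  have hcomp : (fun i => g ((τ.equivFinOfCardEq hcard).symm i : E)) = (g ∘ e) ∘ π :=
    congrArg (fun f => g ∘ f) hπ
  rw [hcomp, coverSign_comp_perm]
  rcases Int.units_eq_one_or (Equiv.Perm.sign π) with h | h <;> simp [h, Left.sign_neg]

theorem movedSign_eq_sum_update [DecidableEq E] {Q : Set E} {y : E}
    (hyQ : InGeneralPosition d Q y) {Φ : E →ₗ[ℝ] (Fin d → ℝ)} {A : AffineSubspace ℝ E}
    (hΦ : ∀ v ∈ A.direction, Φ v = 0 → v = 0) (hy : y ∈ A) {τ : Finset E} (hτ : τ.card = d + 1)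
    {g : E → E} (hg : ∀ v ∈ τ, g v ∈ A) (hgQ : ∀ v ∈ τ, g v ∈ Q) {u : E} (hu : u ∈ A)
    (huQ : u ∈ Q) :
    movedSign Φ y τ g = ∑ w ∈ τ, movedSign Φ y τ (Function.update g w u) := by
  obtain ⟨e, he, hr⟩ := exists_enumeration hτ
  have hmem : ∀ i, e i ∈ τ := fun i => Finset.mem_coe.1 (hr ▸ mem_range_self i)
  have himg : τ = Finset.univ.image e := by
    apply Finset.coe_injective
    rw [Finset.coe_image, Finset.coe_univ, image_univ, hr]
  rw [movedSign_eq Φ y g he hr, coverSign_eq_sum_update (g := g ∘ e) hyQ hΦ hy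
    (fun i => hg _ (hmem i)) (fun i => hgQ _ (hmem i)) hu huQ, Finset.mul_sum]
  conv_rhs => rw [himg]
  rw [Finset.sum_image fun i _ j _ h => he h]
  refine Finset.sum_congr rfl fun j _ => ?_
  rw [← himg, movedSign_eq Φ y _ he hr, update_comp_of_injective he]

end AffineCoordinates

/-! ### Barycentric coordinates as affine functionals. -/

section AffineFunctional

variable {E : Type*} [AddCommGroup E] [Module ℝ E]

theorem AffineMap.map_sum_smul {κ F : Type*} [AddCommGroup F] [Module ℝ F] (β : E →ᵃ[ℝ] F)
    {s : Finset κ} {c : κ → ℝ} (x : κ → E) (hc : ∑ i ∈ s, c i = 1) :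
    β (∑ i ∈ s, c i • x i) = ∑ i ∈ s, c i • β (x i) := by
  have h := Finset.map_affineCombination s x c hc β
  rw [Finset.affineCombination_eq_linear_combination s x c hc,
    Finset.affineCombination_eq_linear_combination s _ c hc] at h
  exact h

/-- Extend `τ` to an affine basis of the whole space and take the coordinate of `w`. -/
theorem exists_coord_functional {τ : Finset E} (hτ : AffineIndependent ℝ ((↑) : τ → E)) {w : E}
    (hw : w ∈ τ) : ∃ β : E →ᵃ[ℝ] ℝ, β w = 1 ∧ ∀ v ∈ τ, v ≠ w → β v = 0 := by
  obtain ⟨t, hst, hind, htop⟩ := exists_subset_affineIndependent_affineSpan_eq_top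
    (s := (τ : Set E)) hτ
  let b : AffineBasis t ℝ E := ⟨Subtype.val, hind, by rw [Subtype.range_coe]; exact htop⟩
  refine ⟨b.coord ⟨w, hst hw⟩, ?_, fun v hv hvw => ?_⟩
  · exact b.coord_apply_eq ⟨w, hst hw⟩
  · exact b.coord_apply_ne (i := ⟨w, hst hw⟩) (j := ⟨v, hst hv⟩) fun h => hvw (by
      simpa using congrArg Subtype.val h.symm)

theorem exists_coeff_of_mem_affineSpan {τ : Finset E} {p : E}
    (hp : p ∈ affineSpan ℝ (τ : Set E)) :
    ∃ c : E → ℝ, ∑ v ∈ τ, c v = 1 ∧ ∑ v ∈ τ, c v • v = p := by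
  classical
  have hp' : p ∈ affineSpan ℝ (range ((↑) : τ → E)) := by
    rwa [show range ((↑) : τ → E) = (τ : Set E) from Subtype.range_coe]
  obtain ⟨w, hw, hpw⟩ := eq_affineCombination_of_mem_affineSpan_of_fintype hp'
  rw [Finset.affineCombination_eq_linear_combination _ _ _ hw] at hpw
  refine ⟨fun v => if h : v ∈ τ then w ⟨v, h⟩ else 0, ?_, ?_⟩
  · rw [← Finset.sum_coe_sort, ← hw]
    simp
  · rw [← Finset.sum_coe_sort, hpw]
    simp

theorem mem_affineSpan_erase [DecidableEq E] {τ : Finset E} {w : E} (hw : w ∈ τ) {β : E →ᵃ[ℝ] ℝ}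
    (hβw : β w = 1) (hβ : ∀ v ∈ τ, v ≠ w → β v = 0) {p : E} (hp : p ∈ affineSpan ℝ (τ : Set E))
    (hβp : β p = 0) : p ∈ affineSpan ℝ ((τ.erase w : Finset E) : Set E) := by
  obtain ⟨c, hc1, rfl⟩ := exists_coeff_of_mem_affineSpan hp
  have hcw : c w = 0 := by
    rw [AffineMap.map_sum_smul β _ hc1, ← Finset.add_sum_erase _ _ hw, hβw,
      Finset.sum_eq_zero fun v hv => by
        rw [hβ v (Finset.mem_of_mem_erase hv) (Finset.ne_of_mem_erase hv), smul_zero]] at hβp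
    simpa using hβp
  rw [← Finset.sum_erase (s := τ) (a := w) (f := fun v => c v • v) (by rw [hcw, zero_smul])]
  refine AffineSubspace.sum_smul_mem ?_ fun v hv => subset_affineSpan ℝ _ (Finset.mem_coe.2 hv)
  rw [Finset.sum_erase _ hcw, hc1]

theorem AffineMap.nonneg_of_mem_convexHull {β : E →ᵃ[ℝ] ℝ} {s : Set E} (h : ∀ v ∈ s, 0 ≤ β v)
    {p : E} (hp : p ∈ convexHull ℝ s) : 0 ≤ β p :=
  convexHull_min (t := β ⁻¹' Ici 0) h ((convex_Ici 0).affine_preimage β) hp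

theorem AffineMap.eq_zero_of_mem_affineSpan {β : E →ᵃ[ℝ] ℝ} {s : Set E} (h : ∀ v ∈ s, β v = 0)
    {p : E} (hp : p ∈ affineSpan ℝ s) : β p = 0 := by
  have : affineSpan ℝ s ≤ (affineSpan ℝ {(0 : ℝ)}).comap β :=
    affineSpan_le.2 fun v hv => by simp [h v hv]
  simpa using this hp

end AffineFunctional

/-! ### Finite closed covers of convex sets. -/

section Covering

/-- A convex set in a finite union of affine subspaces lies in one of them. -/
theorem Convex.exists_subset_affineSubspace {ι E : Type*} [AddCommGroup E] [Module ℝ E]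
    {S : ι → AffineSubspace ℝ E} {C : Set E} (hC : Convex ℝ C) (hne : C.Nonempty) (F : Finset ι)
    (h : C ⊆ ⋃ i ∈ F, (S i : Set E)) : ∃ i ∈ F, C ⊆ S i := by
  classical
  induction F using Finset.induction_on with
  | empty =>
    obtain ⟨x, hx⟩ := hne
    simpa using h hx
  | insert a F _ ih =>
    by_cases hF : C ⊆ ⋃ i ∈ F, (S i : Set E)
    · obtain ⟨i, hi, hCi⟩ := ih hF
      exact ⟨i, Finset.mem_insert_of_mem hi, hCi⟩
    refine ⟨a, Finset.mem_insert_self _ _, fun x hx => ?_⟩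
    obtain ⟨y, hy, hyF⟩ := not_subset.1 hF
    by_contra hxa
    have hline : ∀ t ∈ Icc (0 : ℝ) 1, AffineMap.lineMap x y t ∈ C := fun t ht =>
      hC.lineMap_mem hx hy ht
    have hex : ∀ t : ℝ, ∃ i, t ∈ Icc (0 : ℝ) 1 → i ∈ insert a F ∧ AffineMap.lineMap x y t ∈ S i := by
      intro t
      by_cases ht : t ∈ Icc (0 : ℝ) 1
      · obtain ⟨i, hi, hti⟩ := mem_iUnion₂.1 (h (hline t ht))
        exact ⟨i, fun _ => ⟨hi, hti⟩⟩
      · exact ⟨a, fun h => absurd h ht⟩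
    choose f hf using hex
    -- Infinitely many points of the segment lie in finitely many subspaces. One subspace contains
    -- two of them, hence the whole line and both `x` and `y`; but `y` avoids all subspaces of `F`,
    -- and `x` avoids `S a`.
    obtain ⟨t, ht, t', ht', hne', heq⟩ :=
      (Icc_infinite (zero_lt_one' ℝ)).exists_ne_map_eq_of_mapsTo (f := f)
        (t := ((insert a F : Finset ι) : Set ι)) (fun t ht => (hf t ht).1) (Finset.finite_toSet _)
    have h1 := (hf t ht).2
    have h2 := (hf t' ht').2
    rw [← heq] at h2
    have hall : ∀ r : ℝ, AffineMap.lineMap x y r ∈ S (f t) := by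
      intro r
      have h3 := AffineMap.lineMap_mem ((r - t) / (t' - t)) h1 h2
      have hd : t' - t ≠ 0 := sub_ne_zero.2 hne'.symm
      convert h3 using 1
      rw [← AffineMap.apply_lineMap]
      congr 1
      simp only [AffineMap.lineMap_apply, vsub_eq_sub, smul_eq_mul, vadd_eq_add]
      field_simp
      ring
    have hx' : x ∈ S (f t) := by simpa using hall 0
    have hy' : y ∈ S (f t) := by simpa using hall 1
    rcases Finset.mem_insert.1 (hf t ht).1 with hfa | hfF
    · exact hxa (hfa ▸ hx')
    · exact hyF (mem_iUnion₂.2 ⟨f t, hfF, hy'⟩)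

variable {ι E : Type*} [NormedAddCommGroup E] [NormedSpace ℝ E]

/-- If finitely many closed sets cover a convex set `C`, then near `p ∈ C` in the direction of
`q ∈ C` one of them, whose affine span contains `C`, contains `p` and a further point. -/
theorem Convex.exists_local_cover {K : ι → Set E} (hK : ∀ i, IsClosed (K i)) {C : Set E}
    (hC : Convex ℝ C) (F : Finset ι) (h : C ⊆ ⋃ i ∈ F, K i) {p q : E} (hp : p ∈ C) (hq : q ∈ C) :
    ∃ i ∈ F, p ∈ K i ∧ (∃ δ : ℝ, 0 < δ ∧ δ ≤ 1 ∧ AffineMap.lineMap p q δ ∈ K i) ∧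
      C ⊆ affineSpan ℝ (K i) := by
  have hnear : ∀ z : E, ∀ᶠ z' in nhds z, ∀ i ∈ F, z' ∈ K i → z ∈ K i := by
    intro z
    rw [Filter.eventually_all_finset]
    intro i _
    by_cases hz : z ∈ K i
    · exact Filter.Eventually.of_forall fun _ _ => hz
    · filter_upwards [(hK i).isOpen_compl.mem_nhds hz] with z' hz' h
      exact absurd h hz'
  have hsmall : ∀ (a b : E) (φ : E → Prop), (∀ᶠ z in nhds a, φ z) →
      ∃ δ : ℝ, 0 < δ ∧ δ ≤ 1 ∧ φ (AffineMap.lineMap a b δ) := by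
    intro a b φ hφ
    have hcont : Filter.Tendsto (fun δ : ℝ => (AffineMap.lineMap a b δ : E))
        (nhdsWithin 0 (Ioi 0)) (nhds a) := by
      have : Continuous fun δ : ℝ => (AffineMap.lineMap a b δ : E) := AffineMap.lineMap_continuous
      simpa using (this.tendsto 0).mono_left nhdsWithin_le_nhds
    obtain ⟨δ, hδ, hδ'⟩ := ((hcont.eventually hφ).and
      (Ioc_mem_nhdsGT (zero_lt_one' ℝ))).exists
    exact ⟨δ, hδ'.1, hδ'.2, hδ⟩
  obtain ⟨δ, hδ0, hδ1, hδ⟩ := hsmall p q _ (hnear p)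
  -- Every covering set that contains `z` also contains `p`. The sets containing `z` cover `C` near
  -- `z`, so the affine span of one of them contains that piece of `C`, and hence all of `C`.
  set z := (AffineMap.lineMap p q δ : E) with hz
  have hzC : z ∈ C := hC.lineMap_mem hp hq ⟨hδ0.le, hδ1⟩
  obtain ⟨r, hr, hball⟩ := Metric.eventually_nhds_iff_ball.1 (hnear z)
  classical
  obtain ⟨i, hi, hsub⟩ := Convex.exists_subset_affineSubspace (S := fun i => affineSpan ℝ (K i))
    (hC.inter (convex_ball z r)) ⟨z, hzC, Metric.mem_ball_self hr⟩ (F.filter fun i => z ∈ K i) (by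
      rintro x ⟨hxC, hxr⟩
      obtain ⟨i, hi, hxi⟩ := mem_iUnion₂.1 (h hxC)
      exact mem_iUnion₂.2 ⟨i, Finset.mem_filter.2 ⟨hi, hball x hxr i hi hxi⟩,
        subset_affineSpan ℝ _ hxi⟩)
  obtain ⟨hiF, hzi⟩ := Finset.mem_filter.1 hi
  refine ⟨i, hiF, hδ i hiF hzi, ⟨δ, hδ0, hδ1, hzi⟩, fun x hx => ?_⟩
  obtain ⟨ε, hε0, hε1, hε⟩ := hsmall z x (· ∈ Metric.ball z r) (Metric.ball_mem_nhds z hr)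
  have h1 : (AffineMap.lineMap z x ε : E) ∈ affineSpan ℝ (K i) :=
    hsub ⟨hC.lineMap_mem hzC hx ⟨hε0.le, hε1⟩, hε⟩
  have h2 : z ∈ affineSpan ℝ (K i) := subset_affineSpan ℝ _ hzi
  have h3 := AffineMap.lineMap_mem (ε⁻¹) h2 h1
  rwa [AffineMap.lineMap_lineMap_right, inv_mul_cancel₀ hε0.ne', AffineMap.lineMap_apply_one] at h3

end Covering

/-! ### Relative interiors of minimal cells. -/

namespace Polytope

variable {d n : ℕ} (P : Polytope d n)

/-- A point is in the relative interior of its minimal cell: segments of the cell ending at the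
point can be prolonged. -/
theorem exists_prolong_mem_minimalCell {x m : EuclideanSpace ℝ (Fin n)} (hx : x ∈ P.space)
    (hm : m ∈ P.minimalCell x) :
    ∃ ε : ℝ, 0 < ε ∧ AffineMap.lineMap x m (-ε) ∈ P.minimalCell x := by
  obtain ⟨V, hV, hxV, hVM⟩ := P.exists_minimalCell_eq hx
  set M := P.minimalCell x with hM
  have hxM : x ∈ M := hVM ▸ hxV
  have hMconv : Convex ℝ M := hVM ▸ convex_convexHull ℝ _
  set U := vectorSpan ℝ M with hU
  -- In the direction space of `M`, with `x` as origin, the cell becomes a convex set `B` with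
  -- nonempty interior.
  let φ : U →ᵃ[ℝ] EuclideanSpace ℝ (Fin n) :=
    U.subtype.toAffineMap + AffineMap.const ℝ U x
  have hφ : ∀ u : U, φ u = u + x := fun u => rfl
  have hsubU : ∀ z ∈ M, z - x ∈ U := fun z hz => vsub_mem_vectorSpan ℝ hz hxM
  set B : Set U := φ ⁻¹' M with hB
  have hBconv : Convex ℝ B := hMconv.affine_preimage φ
  have h0B : (0 : U) ∈ B := by simpa [hB, hφ] using hxM
  have hspan : Submodule.span ℝ B = ⊤ := by
    rw [eq_top_iff]
    intro u _
    have hu : (u : EuclideanSpace ℝ (Fin n)) ∈ Submodule.span ℝ ((fun z => z -ᵥ x) '' M) :=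
      vectorSpan_eq_span_vsub_set_right ℝ hxM ▸ u.2
    have himg : (fun z => z -ᵥ x) '' M = U.subtype '' B := by
      ext z
      constructor
      · rintro ⟨m, hm, rfl⟩
        exact ⟨⟨m - x, hsubU m hm⟩, by simpa [hB, hφ] using hm, rfl⟩
      · rintro ⟨u, hu, rfl⟩
        exact ⟨u + x, hu, by simp⟩
    rw [himg, ← Submodule.map_span] at hu
    obtain ⟨v, hv, hvu⟩ := Submodule.mem_map.1 hu
    rwa [Subtype.ext_iff.2 hvu.symm]
  have hint : (interior B).Nonempty := by
    rw [hBconv.interior_nonempty_iff_affineSpan_eq_top,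
      AffineSubspace.affineSpan_eq_top_iff_vectorSpan_eq_top_of_nonempty ℝ U U ⟨0, h0B⟩,
      vectorSpan_eq_span_vsub_set_right ℝ h0B]
    simpa using hspan
  by_cases h0 : (0 : U) ∈ interior B
  · have hcont : Filter.Tendsto (fun ε : ℝ => (-ε) • (⟨m - x, hsubU m hm⟩ : U))
        (nhdsWithin 0 (Ioi 0)) (nhds 0) := by
      have : Continuous fun ε : ℝ => (-ε) • (⟨m - x, hsubU m hm⟩ : U) := by fun_prop
      simpa using (this.tendsto 0).mono_left nhdsWithin_le_nhds
    obtain ⟨ε, hε, hε0⟩ := ((hcont.eventually (mem_interior_iff_mem_nhds.1 h0)).and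
      self_mem_nhdsWithin).exists
    refine ⟨ε, hε0, ?_⟩
    have h1 : φ ((-ε) • (⟨m - x, hsubU m hm⟩ : U)) ∈ M := hε
    rw [hφ] at h1
    simpa [AffineMap.lineMap_apply] using h1
  · exfalso
    -- A supporting functional at `x` exposes a face of `M` through `x`. This face is a cell, so
    -- minimality puts all of `M` into it; the functional is then constant on `M`, hence zero.
    obtain ⟨f, hf0, hf⟩ := geometric_hahn_banach_of_nonempty_interior_point hBconv h0 hint
    obtain ⟨g, hg, -⟩ := exists_extension_norm_eq U f
    have hgM : ∀ z ∈ M, g z ≤ g x := by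
      intro z hz
      have h1 := hf ⟨z - x, hsubU z hz⟩ (by simpa [hB, hφ] using hz)
      rw [← hg, map_zero] at h1
      simpa using h1
    obtain ⟨W, hW, hWF⟩ := P.face_mem V hV {z ∈ M | ∀ q ∈ M, g q ≤ g z} ⟨x, hxM, hgM⟩
      fun _ => ⟨g, by rw [hVM]⟩
    have hMW : M ⊆ convexHull ℝ (W : Set (EuclideanSpace ℝ (Fin n))) :=
      iInter₂_subset W ⟨hW, by rw [hWF]; exact ⟨hxM, hgM⟩⟩
    refine hf0 (ContinuousLinearMap.ext fun u => ?_)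
    have hle : Submodule.span ℝ B ≤ LinearMap.ker (f : U →ₗ[ℝ] ℝ) := by
      rw [Submodule.span_le]
      intro u hu
      have hu' : (u : EuclideanSpace ℝ (Fin n)) + x ∈ M := hu
      have h1 := hMW hu'
      rw [hWF] at h1
      have h2 := le_antisymm (hgM _ hu') (h1.2 x hxM)
      simpa [hg] using h2
    exact hle (hspan ▸ Submodule.mem_top : u ∈ Submodule.span ℝ B)

end Polytope

/-! ### Dimensions of affine spans, and simplices sharing a facet. -/

section FinitePointSets

variable {E : Type*} [AddCommGroup E] [Module ℝ E]

theorem AffineIndependent.finrank_vectorSpan_finset_add_one {s : Finset E} (hs : s.Nonempty)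
    (hind : AffineIndependent ℝ ((↑) : s → E)) :
    Module.finrank ℝ (vectorSpan ℝ (s : Set E)) + 1 = s.card := by
  have : Nonempty s := hs.to_subtype
  have h := hind.finrank_vectorSpan_add_one
  rwa [Fintype.card_coe, show range ((↑) : s → E) = (s : Set E) from Subtype.range_coe] at h

theorem affineSpan_eq_of_le_of_finrank_le [FiniteDimensional ℝ E] {s t : Set E} (hs : s.Nonempty)
    (hle : affineSpan ℝ s ≤ affineSpan ℝ t)
    (hrank : Module.finrank ℝ (vectorSpan ℝ t) ≤ Module.finrank ℝ (vectorSpan ℝ s)) :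
    affineSpan ℝ s = affineSpan ℝ t := by
  have hdir := AffineSubspace.direction_le hle
  refine AffineSubspace.eq_of_direction_eq_of_nonempty_of_le
    (Submodule.eq_of_le_of_finrank_le hdir ?_) ((affineSpan_nonempty ℝ).2 hs) hle
  rwa [direction_affineSpan, direction_affineSpan]

end FinitePointSets

theorem exists_local_cover_convexHull {E : Type*} [NormedAddCommGroup E] [NormedSpace ℝ E]
    {s : Finset E} (F : Finset (Finset E))
    (h : convexHull ℝ (s : Set E) ⊆ ⋃ V ∈ F, convexHull ℝ (V : Set E)) {p q : E}
    (hp : p ∈ convexHull ℝ (s : Set E)) (hq : q ∈ convexHull ℝ (s : Set E)) :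
    ∃ V ∈ F, p ∈ convexHull ℝ (V : Set E) ∧
      (∃ δ : ℝ, 0 < δ ∧ δ ≤ 1 ∧ AffineMap.lineMap p q δ ∈ convexHull ℝ (V : Set E)) ∧
      affineSpan ℝ (s : Set E) ≤ affineSpan ℝ (V : Set E) := by
  obtain ⟨V, hV, hpV, hδ, hsub⟩ := (convex_convexHull ℝ (s : Set E)).exists_local_cover
    (K := fun V : Finset E => convexHull ℝ (V : Set E))
    (fun V => V.finite_toSet.isClosed_convexHull ℝ) F h hp hq
  rw [affineSpan_convexHull] at hsub
  exact ⟨V, hV, hpV, hδ, affineSpan_le.2 ((subset_convexHull ℝ _).trans hsub)⟩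

/-- Two simplices on the same side of a common facet overlap in a point off the facet, whereas
distinct ones can only meet inside the span of `ρ`. -/
theorem Geometry.SimplicialComplex.eq_of_same_side {E : Type*} [AddCommGroup E] [Module ℝ E]
    [DecidableEq E] (T : Geometry.SimplicialComplex ℝ E) {ρ : Finset E} {w₁ w₂ : E} (h₁ : w₁ ∉ ρ)
    (hf₁ : insert w₁ ρ ∈ T.faces) (hf₂ : insert w₂ ρ ∈ T.faces)
    (hspan : w₁ ∈ affineSpan ℝ ((insert w₂ ρ : Finset E) : Set E)) {β : E →ᵃ[ℝ] ℝ}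
    (hβ₂ : β w₂ = 1) (hβρ : ∀ v ∈ ρ, β v = 0) (hβ₁ : 0 < β w₁) : w₁ = w₂ := by
  by_contra hne
  have h₂ : w₂ ∉ ρ := fun h => by simp [hβρ w₂ h] at hβ₂
  obtain ⟨c, hc1, hcw⟩ := exists_coeff_of_mem_affineSpan hspan
  have hc₂ : β w₁ = c w₂ := by
    rw [← hcw, AffineMap.map_sum_smul β _ hc1, Finset.sum_insert h₂, hβ₂,
      Finset.sum_eq_zero fun v hv => by rw [hβρ v hv, smul_zero]]
    simp
  -- Adding weight `K` at each vertex of `ρ` outweighs the negative coefficients of `w₁` over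
  -- `insert w₂ ρ`; dividing by `N` makes the weights sum to 1. The resulting `p` lies in both
  -- simplices, with `β p = β w₁ / N > 0`.
  set K : ℝ := ∑ v ∈ ρ, |c v| with hK
  have hK0 : 0 ≤ K := Finset.sum_nonneg fun v _ => abs_nonneg _
  set N : ℝ := 1 + K * ρ.card with hN
  have hN0 : 0 < N := by positivity
  set p : E := N⁻¹ • (w₁ + K • ∑ v ∈ ρ, v) with hp
  set a : E → ℝ := fun v => if v = w₁ then N⁻¹ else N⁻¹ * K with ha
  have haρ : ∀ v ∈ ρ, a v = N⁻¹ * K := fun v hv => if_neg fun h : v = w₁ => h₁ (h ▸ hv)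
  have ha1 : ∑ v ∈ insert w₁ ρ, a v = 1 := by
    rw [Finset.sum_insert h₁, Finset.sum_congr rfl haρ, Finset.sum_const, ha]
    simp only [if_true, nsmul_eq_mul]
    field_simp
    rw [hN]
    ring
  have hap : ∑ v ∈ insert w₁ ρ, a v • v = p := by
    rw [Finset.sum_insert h₁, Finset.sum_congr rfl fun v hv => by rw [haρ v hv], ← Finset.smul_sum,
      ha, hp]
    simp only [if_true, smul_add, smul_smul]
  have hp₁ : p ∈ convexHull ℝ ((insert w₁ ρ : Finset E) : Set E) := by
    refine Finset.mem_convexHull'.2 ⟨a, fun v _ => ?_, ha1, hap⟩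
    rw [ha]
    dsimp only
    split_ifs <;> positivity
  have hp₂ : p ∈ convexHull ℝ ((insert w₂ ρ : Finset E) : Set E) := by
    set a' : E → ℝ := fun v => N⁻¹ * (c v + if v = w₂ then 0 else K) with ha'
    have haρ' : ∀ v ∈ ρ, a' v = N⁻¹ * (c v + K) := fun v hv => by
      rw [ha']
      dsimp only
      rw [if_neg fun h : v = w₂ => h₂ (h ▸ hv)]
    rw [Finset.sum_insert h₂] at hc1 hcw
    refine Finset.mem_convexHull'.2 ⟨a', fun v hv => ?_, ?_, ?_⟩
    · rcases Finset.mem_insert.1 hv with rfl | hv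
      · rw [ha']
        simp only [if_true, add_zero]
        rw [← hc₂]
        positivity
      · rw [haρ' v hv]
        have := Finset.single_le_sum (f := fun v => |c v|) (fun v _ => abs_nonneg _) hv
        have h3 := neg_abs_le (c v)
        have : 0 ≤ c v + K := by linarith
        positivity
    · rw [Finset.sum_insert h₂, Finset.sum_congr rfl haρ', ← Finset.mul_sum,
        Finset.sum_add_distrib, Finset.sum_const, ha']
      simp only [if_true, add_zero, nsmul_eq_mul]
      rw [← mul_add, ← add_assoc, hc1, hN]
      rw [mul_comm (ρ.card : ℝ) K]
      exact inv_mul_cancel₀ hN0.ne'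
    · rw [Finset.sum_insert h₂, Finset.sum_congr rfl fun v hv => by rw [haρ' v hv, mul_smul,
        add_smul], ← Finset.smul_sum, Finset.sum_add_distrib, ← Finset.smul_sum, ha', hp]
      simp only [if_true, add_zero]
      rw [mul_smul, ← smul_add, ← add_assoc, hcw]
  have hinter := T.inter_subset_convexHull hf₁ hf₂ ⟨hp₁, hp₂⟩
  have hzero : β p = 0 := by
    refine AffineMap.eq_zero_of_mem_affineSpan ?_ (convexHull_subset_affineSpan _ hinter)
    rintro v ⟨hv₁, hv₂⟩
    rcases Finset.mem_insert.1 (Finset.mem_coe.1 hv₁) with rfl | hv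
    · rcases Finset.mem_insert.1 (Finset.mem_coe.1 hv₂) with h | h
      · exact absurd h hne
      · exact absurd h h₁
    · exact hβρ v hv
  rw [← hap, AffineMap.map_sum_smul β _ ha1, Finset.sum_insert h₁,
    Finset.sum_eq_zero fun v hv => by rw [hβρ v hv, smul_zero], ha] at hzero
  simp only [if_true, add_zero, smul_eq_mul] at hzero
  exact (mul_pos (inv_pos.2 hN0) hβ₁).ne' hzero

/-! ### The simplex on the other side of an interior facet. -/

namespace Polytope.IsTriangulation

variable {d n : ℕ} {P : Polytope d n}
  {T : Geometry.SimplicialComplex ℝ (EuclideanSpace ℝ (Fin n))}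

theorem exists_cell (hT : P.IsTriangulation T) {s : Finset (EuclideanSpace ℝ (Fin n))}
    (hs : s ∈ T.faces) {p q : EuclideanSpace ℝ (Fin n)} (hp : p ∈ convexHull ℝ (s : Set (EuclideanSpace ℝ (Fin n))))
    (hq : q ∈ convexHull ℝ (s : Set (EuclideanSpace ℝ (Fin n)))) :
    ∃ V ∈ P.cells, p ∈ convexHull ℝ (V : Set (EuclideanSpace ℝ (Fin n))) ∧
      (∃ δ : ℝ, 0 < δ ∧ δ ≤ 1 ∧
        AffineMap.lineMap p q δ ∈ convexHull ℝ (V : Set (EuclideanSpace ℝ (Fin n)))) ∧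
      affineSpan ℝ (s : Set (EuclideanSpace ℝ (Fin n))) ≤
        affineSpan ℝ (V : Set (EuclideanSpace ℝ (Fin n))) := by
  exact exists_local_cover_convexHull P.cells
    ((Geometry.SimplicialComplex.convexHull_subset_space hs).trans hT.space_eq.subset) hp hq

theorem exists_face (hT : P.IsTriangulation T) {V : Finset (EuclideanSpace ℝ (Fin n))}
    (hV : V ∈ P.cells) {p q : EuclideanSpace ℝ (Fin n)} (hp : p ∈ convexHull ℝ (V : Set (EuclideanSpace ℝ (Fin n))))
    (hq : q ∈ convexHull ℝ (V : Set (EuclideanSpace ℝ (Fin n)))) :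
    ∃ s ∈ T.faces, p ∈ convexHull ℝ (s : Set (EuclideanSpace ℝ (Fin n))) ∧
      (∃ δ : ℝ, 0 < δ ∧ δ ≤ 1 ∧
        AffineMap.lineMap p q δ ∈ convexHull ℝ (s : Set (EuclideanSpace ℝ (Fin n)))) ∧
      affineSpan ℝ (V : Set (EuclideanSpace ℝ (Fin n))) ≤
        affineSpan ℝ (s : Set (EuclideanSpace ℝ (Fin n))) := by
  have hcover : convexHull ℝ (V : Set (EuclideanSpace ℝ (Fin n))) ⊆
      ⋃ s ∈ hT.finite.toFinset, convexHull ℝ (s : Set (EuclideanSpace ℝ (Fin n))) := by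
    intro x hx
    have hx' : x ∈ T.space := hT.space_eq ▸ mem_iUnion₂.2 ⟨V, hV, hx⟩
    obtain ⟨s, hs, hxs⟩ := Geometry.SimplicialComplex.mem_space_iff.1 hx'
    exact mem_iUnion₂.2 ⟨s, hT.finite.mem_toFinset.2 hs, hxs⟩
  obtain ⟨s, hs, h⟩ := exists_local_cover_convexHull hT.finite.toFinset hcover hp hq
  exact ⟨s, hT.finite.mem_toFinset.1 hs, h⟩

theorem card_le (hT : P.IsTriangulation T) {s : Finset (EuclideanSpace ℝ (Fin n))}
    (hs : s ∈ T.faces) : s.card ≤ d + 1 := by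
  obtain ⟨x, hx⟩ := Geometry.SimplicialComplex.nonempty_of_mem_faces hs
  have hx' := subset_convexHull ℝ (s : Set (EuclideanSpace ℝ (Fin n))) hx
  obtain ⟨V, hV, -, -, hle⟩ := hT.exists_cell hs hx' hx'
  have h1 := Submodule.finrank_mono (AffineSubspace.direction_le hle)
  rw [direction_affineSpan, direction_affineSpan] at h1
  have h2 := (T.indep hs).finrank_vectorSpan_finset_add_one ⟨x, hx⟩
  have h3 := P.dim_le V hV
  omega

theorem finrank_eq {τ : Finset (EuclideanSpace ℝ (Fin n))} (hτ : τ ∈ T.faces)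
    (hcard : τ.card = d + 1) :
    Module.finrank ℝ (vectorSpan ℝ (τ : Set (EuclideanSpace ℝ (Fin n)))) = d := by
  have := (T.indep hτ).finrank_vectorSpan_finset_add_one
    (Geometry.SimplicialComplex.nonempty_of_mem_faces hτ)
  omega

/-- Some cell through `x` has an affine span containing that of `τ`. Since cells have dimension at
most `d`, the spans agree, and the minimal cell lies in that cell. -/
theorem minimalCell_subset (hT : P.IsTriangulation T) {τ : Finset (EuclideanSpace ℝ (Fin n))}
    (hτ : τ ∈ T.faces) (hcard : τ.card = d + 1) {x : EuclideanSpace ℝ (Fin n)}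
    (hx : x ∈ convexHull ℝ (τ : Set (EuclideanSpace ℝ (Fin n)))) :
    P.minimalCell x ⊆ affineSpan ℝ (τ : Set (EuclideanSpace ℝ (Fin n))) := by
  obtain ⟨V, hV, hxV, -, hle⟩ := hT.exists_cell hτ hx hx
  rw [affineSpan_eq_of_le_of_finrank_le (Geometry.SimplicialComplex.nonempty_of_mem_faces hτ) hle
    (by rw [finrank_eq hτ hcard]; exact P.dim_le V hV)]
  exact (iInter₂_subset V ⟨hV, hxV⟩).trans (convexHull_subset_affineSpan _)

/-- The minimal cell of `x` has a point `m'` beyond the facet. A cell `V` of full dimension contains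
`x`, hence `m'`, and also a point `z` near `x` towards the barycentre of the facet. A simplex
containing the start of the segment from `z` to `m'` has the facet as a face, because `z` has
positive coordinates at all its vertices, and it lies beyond the facet. -/
theorem exists_opposite_face (hT : P.IsTriangulation T)
    [DecidableEq (EuclideanSpace ℝ (Fin n))] {τ : Finset (EuclideanSpace ℝ (Fin n))}
    (hτ : τ ∈ T.faces) (hcard : τ.card = d + 1) {w : EuclideanSpace ℝ (Fin n)} (hw : w ∈ τ)
    {β : EuclideanSpace ℝ (Fin n) →ᵃ[ℝ] ℝ} (hβw : β w = 1) (hβ : ∀ v ∈ τ, v ≠ w → β v = 0)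
    {x m : EuclideanSpace ℝ (Fin n)} (hx : x ∈ τ.erase w) (hm : m ∈ P.minimalCell x)
    (hmρ : m ∉ affineSpan ℝ ((τ.erase w : Finset _) : Set (EuclideanSpace ℝ (Fin n)))) :
    ∃ w' ∉ τ.erase w, insert w' (τ.erase w) ∈ T.faces ∧
      affineSpan ℝ ((insert w' (τ.erase w) : Finset _) : Set (EuclideanSpace ℝ (Fin n))) =
        affineSpan ℝ (τ : Set (EuclideanSpace ℝ (Fin n))) ∧ β w' < 0 := by
  have hne := Geometry.SimplicialComplex.nonempty_of_mem_faces hτ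
  set ρ := τ.erase w with hρ
  have hρf : ρ ∈ T.faces := T.down_closed hτ (Finset.erase_subset _ _) ⟨x, hx⟩
  have hβρ : ∀ v ∈ ρ, β v = 0 := fun v hv =>
    hβ v (Finset.mem_of_mem_erase hv) (Finset.ne_of_mem_erase hv)
  have hxτ := subset_convexHull ℝ (τ : Set (EuclideanSpace ℝ (Fin n))) (Finset.mem_of_mem_erase hx)
  have hxρ := subset_convexHull ℝ (ρ : Set (EuclideanSpace ℝ (Fin n))) hx
  have hxP : x ∈ P.space := hT.space_eq ▸ T.subset_space hρf hx
  have hρτ : convexHull ℝ (ρ : Set (EuclideanSpace ℝ (Fin n))) ⊆ convexHull ℝ (τ : Set (EuclideanSpace ℝ (Fin n))) :=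
    convexHull_mono (Finset.coe_subset.2 (Finset.erase_subset _ _))
  -- If `m` is on the side of `w`, the segment from `m` to `x` is prolonged beyond `x` within the
  -- minimal cell.
  obtain ⟨m', hm', hβm'⟩ : ∃ m' ∈ P.minimalCell x, β m' < 0 := by
    have hβm : β m ≠ 0 := fun h =>
      hmρ (mem_affineSpan_erase hw hβw hβ (hT.minimalCell_subset hτ hcard hxτ hm) h)
    rcases lt_or_gt_of_ne hβm with h | h
    · exact ⟨m, hm, h⟩
    · obtain ⟨ε, hε, hmε⟩ := P.exists_prolong_mem_minimalCell hxP hm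
      refine ⟨_, hmε, ?_⟩
      rw [AffineMap.apply_lineMap, hβρ x hx, AffineMap.lineMap_apply]
      simpa using mul_pos hε h
  set k : ℝ := (ρ.card : ℝ) with hk
  have hk0 : 0 < k := by
    rw [hk]
    exact_mod_cast Finset.card_pos.2 ⟨x, hx⟩
  set b : EuclideanSpace ℝ (Fin n) := ∑ v ∈ ρ, k⁻¹ • v with hb
  have hk1 : ∑ v ∈ ρ, k⁻¹ = 1 := by
    rw [Finset.sum_const, nsmul_eq_mul, mul_inv_cancel₀ hk0.ne']
  have hbρ : b ∈ convexHull ℝ (ρ : Set (EuclideanSpace ℝ (Fin n))) :=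
    Finset.mem_convexHull'.2 ⟨fun _ => k⁻¹, fun _ _ => by positivity, hk1, rfl⟩
  obtain ⟨V, hV, hxV, ⟨δ, hδ0, hδ1, hzV⟩, hτV⟩ := hT.exists_cell hτ hxτ (hρτ hbρ)
  have hm'V : m' ∈ convexHull ℝ (V : Set (EuclideanSpace ℝ (Fin n))) :=
    (iInter₂_subset V ⟨hV, hxV⟩ : P.minimalCell x ⊆ _) hm'
  set z : EuclideanSpace ℝ (Fin n) := AffineMap.lineMap x b δ with hz
  obtain ⟨τ', hτ', hzτ', ⟨δ', hδ'0, -, hz'⟩, hVτ'⟩ := hT.exists_face hV hzV hm'V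
  have hzρ : z ∈ convexHull ℝ (ρ : Set (EuclideanSpace ℝ (Fin n))) :=
    (convex_convexHull ℝ _).lineMap_mem hxρ hbρ ⟨hδ0.le, hδ1⟩
  have hle := hτV.trans hVτ'
  have hrank := (T.indep hτ').finrank_vectorSpan_finset_add_one
    (Geometry.SimplicialComplex.nonempty_of_mem_faces hτ')
  have hcard_le := hT.card_le hτ'
  have hspan := affineSpan_eq_of_le_of_finrank_le hne hle
    (by rw [finrank_eq hτ hcard]; omega)
  have hrank' := Submodule.finrank_mono (AffineSubspace.direction_le hle)
  rw [direction_affineSpan, direction_affineSpan, finrank_eq hτ hcard] at hrank'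
  -- A vertex of `ρ` missing from `τ'` would have coordinate 0 at `z`, but this coordinate is at
  -- least `δ / k > 0`.
  have hsub : ρ ⊆ τ' := by
    intro v hv
    by_contra hvτ'
    obtain ⟨α, hαv, hα⟩ := exists_coord_functional (T.indep hρf) hv
    have h1 : α z = 0 := by
      refine AffineMap.eq_zero_of_mem_affineSpan ?_
        (convexHull_subset_affineSpan _ (T.inter_subset_convexHull hρf hτ' ⟨hzρ, hzτ'⟩))
      rintro u ⟨huρ, huτ'⟩
      exact hα u huρ fun h => hvτ' (h ▸ huτ')
    have h2 : α b = k⁻¹ := by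
      rw [hb, AffineMap.map_sum_smul α _ hk1, ← Finset.add_sum_erase _ _ hv, hαv,
        Finset.sum_eq_zero fun u hu => by
          rw [hα u (Finset.mem_of_mem_erase hu) (Finset.ne_of_mem_erase hu), smul_zero]]
      simp
    have h3 : 0 ≤ α x := by
      by_cases h : x = v
      · rw [h, hαv]; exact zero_le_one
      · rw [hα x hx h]
    rw [hz, AffineMap.apply_lineMap, AffineMap.lineMap_apply_module, h2, smul_eq_mul,
      smul_eq_mul] at h1
    have h4 := mul_nonneg (sub_nonneg.2 hδ1) h3
    have h5 := mul_pos hδ0 (inv_pos.2 hk0)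
    linarith
  have hρcard : ρ.card + 1 = τ'.card := by
    rw [hρ, Finset.card_erase_of_mem hw]
    omega
  obtain ⟨w', hw', rfl⟩ := Finset.exists_eq_insert_iff.2 ⟨hsub, hρcard⟩
  refine ⟨w', hw', hτ', hspan.symm, ?_⟩
  by_contra hβw'
  have h1 : 0 ≤ β (AffineMap.lineMap z m' δ') := by
    refine AffineMap.nonneg_of_mem_convexHull (fun v hv => ?_) hz'
    rcases Finset.mem_insert.1 (Finset.mem_coe.1 hv) with rfl | hv
    · exact not_lt.1 hβw'
    · exact (hβρ v hv).ge
  rw [AffineMap.apply_lineMap,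
    AffineMap.eq_zero_of_mem_affineSpan hβρ (convexHull_subset_affineSpan _ hzρ),
    AffineMap.lineMap_apply] at h1
  simp only [vsub_eq_sub, sub_zero, smul_eq_mul, vadd_eq_add, add_zero] at h1
  exact (mul_neg_of_pos_of_neg hδ'0 hβm').not_ge h1

end Polytope.IsTriangulation

/-! ### Comparing the signs of simplices with a common facet. -/

section MovedSign

variable {d : ℕ} {E : Type*} [AddCommGroup E] [Module ℝ E]

theorem movedSign_congr (Φ : E →ₗ[ℝ] (Fin d → ℝ)) (y : E) {τ : Finset E} {g g' : E → E}
    (h : ∀ v ∈ τ, g v = g' v) : movedSign Φ y τ g = movedSign Φ y τ g' := by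
  unfold movedSign
  split_ifs with hcard
  · simp_rw [h _ (Subtype.prop _)]
  · rfl

/-- With `w` and `w'` both sent to `u`, the two image simplices coincide. Only the reference
orientations differ, and their determinants have ratio `β w'`. -/
theorem movedSign_insert [DecidableEq E] (Φ : E →ₗ[ℝ] (Fin d → ℝ)) (y : E) {ρ : Finset E}
    {w w' : E} (hw : w ∉ ρ) (hw' : w' ∉ ρ) (hρ : ρ.card = d)
    (hspan : w' ∈ affineSpan ℝ ((insert w ρ : Finset E) : Set E)) {β : E →ᵃ[ℝ] ℝ} (hβw : β w = 1)
    (hβ : ∀ v ∈ ρ, β v = 0) (g : E → E) (u : E) :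
    movedSign Φ y (insert w' ρ) (Function.update g w' u) =
      (SignType.sign (β w') : ℤ) * movedSign Φ y (insert w ρ) (Function.update g w u) := by
  obtain ⟨e, he, hr⟩ := exists_enumeration
    (show (insert w ρ).card = d + 1 by rw [Finset.card_insert_of_notMem hw, hρ])
  have hmem : ∀ i, e i ∈ insert w ρ := fun i => Finset.mem_coe.1 (hr ▸ mem_range_self i)
  obtain ⟨j, hj⟩ : w ∈ range e := hr ▸ Finset.mem_coe.2 (Finset.mem_insert_self w ρ)
  have heρ : ∀ i, i ≠ j → e i ∈ ρ := fun i hij =>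
    (Finset.mem_insert.1 (hmem i)).resolve_left fun h => hij (he (h.trans hj.symm))
  set e' := Function.update e j w' with he'
  have he'i : ∀ i, i ≠ j → e' i = e i := fun i hij => Function.update_of_ne hij _ _
  have he'j : e' j = w' := Function.update_self _ _ _
  have hinj : Function.Injective e' := by
    intro a b hab
    by_cases ha : a = j <;> by_cases hb : b = j
    · rw [ha, hb]
    · rw [ha, he'j, he'i b hb] at hab
      exact absurd (hab ▸ heρ b hb) hw'
    · rw [hb, he'j, he'i a ha] at hab
      exact absurd (hab ▸ heρ a ha) hw'
    · rw [he'i a ha, he'i b hb] at hab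
      exact he hab
  have hr' : range e' = ((insert w' ρ : Finset E) : Set E) := by
    ext x
    rw [Finset.coe_insert, mem_insert_iff, Finset.mem_coe]
    constructor
    · rintro ⟨i, rfl⟩
      by_cases hi : i = j
      · exact Or.inl (hi ▸ he'j)
      · exact Or.inr (he'i i hi ▸ heρ i hi)
    · rintro (rfl | hx)
      · exact ⟨j, he'j⟩
      · obtain ⟨i, rfl⟩ : x ∈ range e := hr ▸ Finset.mem_coe.2 (Finset.mem_insert_of_mem hx)
        have hi : i ≠ j := fun h => hw (by rwa [h, hj] at hx)
        exact ⟨i, he'i i hi⟩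
  have hcomp : Function.update g w' u ∘ e' = Function.update g w u ∘ e := by
    funext i
    by_cases hi : i = j
    · subst hi
      simp [he'j, hj]
    · have h1 : e i ≠ w' := fun h => hw' (h ▸ heρ i hi)
      have h2 : e i ≠ w := fun h => hw (h ▸ heρ i hi)
      simp [he'i i hi, h1, h2]
  have hdet : simplexDet Φ e' = β w' * simplexDet Φ e := by
    obtain ⟨c, hc1, hcw⟩ := exists_coeff_of_mem_affineSpan hspan
    have himg : insert w ρ = Finset.univ.image e := by
      apply Finset.coe_injective
      rw [Finset.coe_image, Finset.coe_univ, image_univ, hr]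
    rw [himg, Finset.sum_image fun a _ b _ h => he h] at hc1 hcw
    have hcj : β w' = c (e j) := by
      rw [← hcw, AffineMap.map_sum_smul β _ hc1, Finset.sum_eq_single j, hj, hβw]
      · simp
      · intro i _ hij
        rw [hβ _ (heρ i hij), smul_zero]
      · simp
    rw [hcj, he', ← hcw]
    exact simplexDet_update_sum Φ e j hc1
  rw [movedSign_eq Φ y _ hinj hr', movedSign_eq Φ y _ he hr, hcomp, hdet, sign_mul,
    SignType.coe_mul, mul_assoc]

theorem finrank_vectorSpan_image_of_movedSign_ne_zero {Φ : E →ₗ[ℝ] (Fin d → ℝ)} {y : E}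
    {τ : Finset E} {g : E → E} (h : movedSign Φ y τ g ≠ 0) :
    Module.finrank ℝ (vectorSpan ℝ (g '' τ)) = d := by
  have hcard : τ.card = d + 1 := by
    by_contra hcard
    exact h (dif_neg hcard)
  obtain ⟨e, he, hr⟩ := exists_enumeration hcard
  rw [movedSign_eq Φ y g he hr] at h
  have hdet : simplexDet Φ (g ∘ e) ≠ 0 := by
    intro h0
    simp [coverSign, h0] at h
  rw [← hr, ← range_comp]
  exact (affineIndependent_of_simplexDet_ne_zero hdet).finrank_vectorSpan (by simp)

end MovedSign

/-! ### Invariance of the signed count when one vertex moves. -/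

namespace Polytope.IsTriangulation

variable {d n : ℕ} {P : Polytope d n}
  {T : Geometry.SimplicialComplex ℝ (EuclideanSpace ℝ (Fin n))}

theorem affineSpan_minimalCell_le (hT : P.IsTriangulation T)
    {τ : Finset (EuclideanSpace ℝ (Fin n))} (hτ : τ ∈ T.faces) (hcard : τ.card = d + 1)
    {x : EuclideanSpace ℝ (Fin n)} (hx : x ∈ τ) :
    affineSpan ℝ (P.minimalCell x) ≤ affineSpan ℝ (τ : Set (EuclideanSpace ℝ (Fin n))) :=
  affineSpan_le.2 (hT.minimalCell_subset hτ hcard (subset_convexHull ℝ _ hx))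

/-- If moving the vertices inside their minimal cells, and the vertex `w` inside the minimal cell
of another vertex, leaves `τ` nondegenerate, then the facet opposite to `w` is interior. -/
theorem exists_opposite_face_of_movedSign_ne_zero (hT : P.IsTriangulation T)
    [DecidableEq (EuclideanSpace ℝ (Fin n))] {τ : Finset (EuclideanSpace ℝ (Fin n))}
    (hτ : τ ∈ T.faces) (hcard : τ.card = d + 1) {v w : EuclideanSpace ℝ (Fin n)} (hw : w ∈ τ)
    (hv : v ∈ τ.erase w) {β : EuclideanSpace ℝ (Fin n) →ᵃ[ℝ] ℝ} (hβw : β w = 1)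
    (hβ : ∀ v ∈ τ, v ≠ w → β v = 0) {Φ : EuclideanSpace ℝ (Fin n) →ₗ[ℝ] (Fin d → ℝ)}
    {y u : EuclideanSpace ℝ (Fin n)} {g : EuclideanSpace ℝ (Fin n) → EuclideanSpace ℝ (Fin n)}
    (hg : ∀ x ∈ T.vertices, g x ∈ affineSpan ℝ (P.minimalCell x))
    (hu : u ∈ affineSpan ℝ (P.minimalCell v))
    (hne : movedSign Φ y τ (Function.update g w u) ≠ 0) :
    ∃ w' ∉ τ.erase w, insert w' (τ.erase w) ∈ T.faces ∧
      affineSpan ℝ ((insert w' (τ.erase w) : Finset _) : Set (EuclideanSpace ℝ (Fin n))) =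
        affineSpan ℝ (τ : Set (EuclideanSpace ℝ (Fin n))) ∧ β w' < 0 := by
  set H := affineSpan ℝ ((τ.erase w : Finset _) : Set (EuclideanSpace ℝ (Fin n))) with hH
  by_cases hall : ∀ x ∈ τ.erase w, P.minimalCell x ⊆ H
  · exfalso
    -- All moved vertices of `τ` would lie in `H`, which has dimension `d - 1`, whereas a nonzero
    -- sign requires the image to have dimension `d`.
    have himage : Function.update g w u '' (τ : Set (EuclideanSpace ℝ (Fin n))) ⊆ H := by
      rintro _ ⟨x, hx, rfl⟩
      by_cases hxw : x = w
      · subst hxw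
        rw [Function.update_self]
        exact affineSpan_le.2 (hall v hv) hu
      · rw [Function.update_of_ne hxw]
        have hxe := Finset.mem_erase.2 ⟨hxw, Finset.mem_coe.1 hx⟩
        refine affineSpan_le.2 (hall x hxe) (hg x ?_)
        exact T.down_closed hτ (Finset.singleton_subset_iff.2 (Finset.mem_coe.1 hx))
          (Finset.singleton_nonempty x)
    have h1 := Submodule.finrank_mono (AffineSubspace.direction_le (affineSpan_le.2 himage))
    rw [direction_affineSpan, hH, direction_affineSpan,
      finrank_vectorSpan_image_of_movedSign_ne_zero hne] at h1
    have hρ : τ.erase w ∈ T.faces := T.down_closed hτ (Finset.erase_subset _ _) ⟨v, hv⟩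
    have h2 := (T.indep hρ).finrank_vectorSpan_finset_add_one ⟨v, hv⟩
    rw [Finset.card_erase_of_mem hw] at h2
    omega
  · push Not at hall
    obtain ⟨x, hx, hxH⟩ := hall
    obtain ⟨m, hm, hmH⟩ := not_subset.1 hxH
    exact hT.exists_opposite_face hτ hcard hw hβw hβ hx hm hmH

/-- Moving one vertex inside the affine span of its minimal cell does not change the signed number
of simplices covering a point in general position. -/
theorem sum_movedSign_update (hT : P.IsTriangulation T)
    [DecidableEq (EuclideanSpace ℝ (Fin n))] {Q : Set (EuclideanSpace ℝ (Fin n))}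
    {y : EuclideanSpace ℝ (Fin n)} (hyQ : InGeneralPosition d Q y)
    {A : AffineSubspace ℝ (EuclideanSpace ℝ (Fin n))}
    {Φ : EuclideanSpace ℝ (Fin n) →ₗ[ℝ] (Fin d → ℝ)}
    (hΦ : ∀ v ∈ A.direction, Φ v = 0 → v = 0) (hy : y ∈ A)
    {S : Finset (Finset (EuclideanSpace ℝ (Fin n)))}
    (hS : ∀ τ, τ ∈ S ↔ τ ∈ T.faces ∧ τ.card = d + 1 ∧
      affineSpan ℝ (τ : Set (EuclideanSpace ℝ (Fin n))) = A)
    {g : EuclideanSpace ℝ (Fin n) → EuclideanSpace ℝ (Fin n)}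
    (hg : ∀ x ∈ T.vertices, g x ∈ affineSpan ℝ (P.minimalCell x))
    (hgQ : ∀ x ∈ T.vertices, g x ∈ Q) {v u : EuclideanSpace ℝ (Fin n)}
    (hu : u ∈ affineSpan ℝ (P.minimalCell v)) (huQ : u ∈ Q) :
    ∑ τ ∈ S, movedSign Φ y τ (Function.update g v u) = ∑ τ ∈ S, movedSign Φ y τ g := by
  have hvert : ∀ {τ x}, τ ∈ T.faces → x ∈ τ → x ∈ T.vertices := fun hτ hx =>
    T.down_closed hτ (Finset.singleton_subset_iff.2 hx) (Finset.singleton_nonempty _)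
  have hdiff : ∀ τ ∈ S, movedSign Φ y τ g = movedSign Φ y τ (Function.update g v u) +
      if v ∈ τ then ∑ w ∈ τ.erase v, movedSign Φ y τ (Function.update g w u) else 0 := by
    intro τ hτS
    obtain ⟨hτ, hcard, hA⟩ := (hS τ).1 hτS
    by_cases hv : v ∈ τ
    · rw [if_pos hv, Finset.add_sum_erase τ (fun w => movedSign Φ y τ (Function.update g w u)) hv]
      exact movedSign_eq_sum_update hyQ hΦ hy hcard
        (fun x hx => hA ▸ hT.affineSpan_minimalCell_le hτ hcard hx (hg x (hvert hτ hx)))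
        (fun x hx => hgQ x (hvert hτ hx)) (hA ▸ hT.affineSpan_minimalCell_le hτ hcard hv hu) huQ
    · rw [if_neg hv, add_zero]
      refine movedSign_congr Φ y fun x hx => ?_
      rw [Function.update_of_ne fun h : x = v => hv (h ▸ hx)]
  rw [Finset.sum_congr rfl hdiff, Finset.sum_add_distrib, left_eq_add, ← Finset.sum_filter,
    Finset.sum_sigma']
  set s := (S.filter fun τ => v ∈ τ).sigma fun τ => τ.erase v with hs
  have hmem : ∀ p : (_ : Finset (EuclideanSpace ℝ (Fin n))) × EuclideanSpace ℝ (Fin n),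
      p ∈ s ↔ p.1 ∈ S ∧ v ∈ p.1 ∧ p.2 ≠ v ∧ p.2 ∈ p.1 := by
    intro p
    rw [hs, Finset.mem_sigma, Finset.mem_filter, Finset.mem_erase, and_assoc]
  -- The error terms are grouped by the facet `τ.erase w`; each group is either identically zero or
  -- a cancelling pair.
  rw [← Finset.sum_fiberwise_of_maps_to (g := fun p => p.1.erase p.2)
    (t := s.image fun p => p.1.erase p.2) fun p hp => Finset.mem_image_of_mem _ hp]
  refine Finset.sum_eq_zero fun ρ _ => ?_
  by_cases hzero : ∀ p ∈ s.filter (fun p => p.1.erase p.2 = ρ),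
      movedSign Φ y p.1 (Function.update g p.2 u) = 0
  · exact Finset.sum_eq_zero hzero
  push Not at hzero
  obtain ⟨⟨τ, w⟩, hp, hne⟩ := hzero
  obtain ⟨hps, hρ⟩ := Finset.mem_filter.1 hp
  obtain ⟨hτS, hvτ, hwv, hwτ⟩ := (hmem _).1 hps
  dsimp only at hne hρ hτS hvτ hwv hwτ
  obtain ⟨hτ, hcard, hA⟩ := (hS τ).1 hτS
  obtain ⟨β, hβw, hβ⟩ := exists_coord_functional (T.indep hτ) hwτ
  obtain ⟨w', hw', hτ', hspan, hβw'⟩ := hT.exists_opposite_face_of_movedSign_ne_zero hτ hcard hwτ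
    (Finset.mem_erase.2 ⟨hwv.symm, hvτ⟩) hβw hβ hg hu hne
  have hβρ : ∀ x ∈ ρ, β x = 0 := fun x hx => by
    rw [← hρ] at hx
    exact hβ x (Finset.mem_of_mem_erase hx) (Finset.ne_of_mem_erase hx)
  have hρcard : ρ.card = d := by
    rw [← hρ, Finset.card_erase_of_mem hwτ, hcard, Nat.add_sub_cancel]
  have hwρ : w ∉ ρ := by rw [← hρ]; exact Finset.notMem_erase w τ
  have hτeq : τ = insert w ρ := by rw [← hρ, Finset.insert_erase hwτ]
  have hvρ : v ∈ ρ := by rw [← hρ]; exact Finset.mem_erase.2 ⟨hwv.symm, hvτ⟩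
  rw [hρ] at hw' hτ' hspan
  have hinA : ∀ x : EuclideanSpace ℝ (Fin n), insert x ρ ∈ S →
      x ∈ affineSpan ℝ ((insert w ρ : Finset _) : Set (EuclideanSpace ℝ (Fin n))) := by
    intro x hx
    rw [← hτeq, hA, ← ((hS _).1 hx).2.2]
    exact subset_affineSpan ℝ _ (Finset.mem_coe.2 (Finset.mem_insert_self x ρ))
  have hτ'S : insert w' ρ ∈ S := (hS _).2
    ⟨hτ', by rw [Finset.card_insert_of_notMem hw', hρcard], hspan.trans hA⟩
  have hsign : ∀ x ∉ ρ, insert x ρ ∈ S → movedSign Φ y (insert x ρ) (Function.update g x u) =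
      (SignType.sign (β x) : ℤ) * movedSign Φ y (insert w ρ) (Function.update g w u) :=
    fun x hx hxS => movedSign_insert Φ y hwρ hx hρcard (hinA x hxS) hβw hβρ g u
  have hfiber : s.filter (fun p => p.1.erase p.2 = ρ) = {⟨insert w ρ, w⟩, ⟨insert w' ρ, w'⟩} := by
    ext p
    rw [Finset.mem_filter, hmem, Finset.mem_insert, Finset.mem_singleton]
    constructor
    · rintro ⟨⟨hpS, hvp, hpv, hpp⟩, hpρ⟩
      obtain ⟨τ₁, w₁⟩ := p
      dsimp only at hpS hvp hpv hpp hpρ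
      have hw₁ : w₁ ∉ ρ := by rw [← hpρ]; exact Finset.notMem_erase w₁ τ₁
      obtain rfl : τ₁ = insert w₁ ρ := by rw [← hpρ, Finset.insert_erase hpp]
      have hf₁ := ((hS _).1 hpS).1
      rcases lt_trichotomy (β w₁) 0 with h | h | h
      · right
        -- Dividing by the negative number `β w'` turns `β` into the functional that is 1 at `w'`
        -- and positive on its side.
        have := T.eq_of_same_side hw₁ hf₁ hτ' (β := (β w')⁻¹ • β) (by
            rw [hspan, hτeq]; exact hinA w₁ hpS)
          (by simp [hβw'.ne]) (fun x hx => by simp [hβρ x hx])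
          (by simpa using mul_pos_of_neg_of_neg (inv_lt_zero.2 hβw') h)
        rw [this]
      · exfalso
        -- With `β w₁ = 0` the apex would lie in the span of `ρ`, against the affine independence of
        -- `insert w₁ ρ`.
        have h1 := mem_affineSpan_erase hwτ hβw hβ (hτeq ▸ hinA w₁ hpS) h
        rw [hρ] at h1
        obtain ⟨α, hα₁, hα⟩ := exists_coord_functional (T.indep hf₁) (Finset.mem_insert_self w₁ ρ)
        have h2 := AffineMap.eq_zero_of_mem_affineSpan (β := α) (fun x hx =>
          hα x (Finset.mem_insert_of_mem hx) fun h => hw₁ (h ▸ hx)) h1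
        rw [hα₁] at h2
        exact one_ne_zero h2
      · left
        have := T.eq_of_same_side hw₁ hf₁ (hτeq ▸ hτ) (hinA w₁ hpS) hβw hβρ h
        rw [this]
    · have hgood : ∀ x ∉ ρ, insert x ρ ∈ S → (insert x ρ ∈ S ∧ v ∈ insert x ρ ∧ x ≠ v ∧
          x ∈ insert x ρ) ∧ (insert x ρ).erase x = ρ := fun x hx hxS =>
        ⟨⟨hxS, Finset.mem_insert_of_mem hvρ, fun h => hx (h ▸ hvρ), Finset.mem_insert_self _ _⟩,
          Finset.erase_insert hx⟩
      rintro (rfl | rfl)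
      · exact hgood w hwρ (hτeq ▸ hτS)
      · exact hgood w' hw' hτ'S
  have hww' : w ≠ w' := by
    rintro rfl
    rw [hβw] at hβw'
    exact absurd hβw' (not_lt.2 zero_le_one)
  rw [hfiber, Finset.sum_pair fun h => hww' (by simpa using congrArg Sigma.snd h),
    hsign w' hw' hτ'S, sign_neg hβw']
  simp

end Polytope.IsTriangulation

/-! ### General position holds almost everywhere. -/

section NullSets

variable {d n : ℕ}

theorem euclideanHausdorffMeasure_affineSubspace_eq_zero
    {B : AffineSubspace ℝ (EuclideanSpace ℝ (Fin n))}
    (hB : Module.finrank ℝ B.direction < d) :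
    (μHE[d] : Measure (EuclideanSpace ℝ (Fin n))) B = 0 := by
  rcases (B : Set (EuclideanSpace ℝ (Fin n))).eq_empty_or_nonempty with h | ⟨p, hp⟩
  · rw [h, measure_empty]
  have hiso : Isometry fun v : B.direction => (v : EuclideanSpace ℝ (Fin n)) + p := by
    refine Isometry.of_dist_eq fun v w => ?_
    simp [Subtype.dist_eq]
  have himg : (B : Set (EuclideanSpace ℝ (Fin n))) =
      (fun v : B.direction => (v : EuclideanSpace ℝ (Fin n)) + p) '' univ := by
    ext x
    constructor
    · intro hx
      exact ⟨⟨x - p, AffineSubspace.vsub_mem_direction hx hp⟩, mem_univ _, by simp⟩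
    · rintro ⟨v, -, rfl⟩
      exact AffineSubspace.vadd_mem_of_mem_direction v.2 hp
  rw [himg, hiso.euclideanHausdorffMeasure_image, Measure.euclideanHausdorffMeasure_def,
    Measure.smul_apply,
    Real.hausdorffMeasure_of_finrank_lt (E := B.direction) (by exact_mod_cast hB)]
  simp

/-- There are finitely many spans to avoid, and at most `d` points span dimension less than `d`. -/
theorem ae_inGeneralPosition {Q : Set (EuclideanSpace ℝ (Fin n))} (hQ : Q.Finite) :
    ∀ᵐ y ∂(μHE[d] : Measure (EuclideanSpace ℝ (Fin n))), InGeneralPosition d Q y := by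
  classical
  have h : ∀ᵐ y ∂(μHE[d] : Measure (EuclideanSpace ℝ (Fin n))),
      ∀ S ∈ hQ.toFinset.powerset, S.card ≤ d →
        y ∉ affineSpan ℝ (S : Set (EuclideanSpace ℝ (Fin n))) := by
    rw [Filter.eventually_all_finset]
    intro S _
    by_cases hS : S.card ≤ d
    · have hnull : (μHE[d] : Measure (EuclideanSpace ℝ (Fin n)))
          (affineSpan ℝ (S : Set (EuclideanSpace ℝ (Fin n)))) = 0 := by
        rcases S.eq_empty_or_nonempty with rfl | hne
        · simp
        refine euclideanHausdorffMeasure_affineSubspace_eq_zero ?_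
        rw [direction_affineSpan]
        obtain ⟨m, hm⟩ : ∃ m, S.card = m + 1 :=
          ⟨S.card - 1, (Nat.succ_pred_eq_of_pos hne.card_pos).symm⟩
        have := finrank_vectorSpan_image_finset_le ℝ (id : EuclideanSpace ℝ (Fin n) → _) S hm
        rw [Finset.image_id] at this
        omega
      filter_upwards [measure_eq_zero_iff_ae_notMem.1 hnull] with y hy _ using hy
    · exact Filter.Eventually.of_forall fun y h => absurd h hS
  filter_upwards [h] with y hy S hSQ hS
  exact hy S (Finset.mem_powerset.2 fun x hx => hQ.mem_toFinset.2 (hSQ hx)) hS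

theorem finrank_direction_inf_lt {E : Type*} [AddCommGroup E] [Module ℝ E] [FiniteDimensional ℝ E]
    {A B : AffineSubspace ℝ E} (hA : Module.finrank ℝ A.direction = d)
    (hB : Module.finrank ℝ B.direction = d) (hne : A ≠ B)
    (hp : ((A ⊓ B : AffineSubspace ℝ E) : Set E).Nonempty) :
    Module.finrank ℝ (A ⊓ B).direction < d := by
  have hle : (A ⊓ B).direction ≤ A.direction := AffineSubspace.direction_le inf_le_left
  have hle' : (A ⊓ B).direction ≤ B.direction := AffineSubspace.direction_le inf_le_right
  by_contra hcon
  rw [not_lt] at hcon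
  have h1 := AffineSubspace.eq_of_direction_eq_of_nonempty_of_le
    (Submodule.eq_of_le_of_finrank_le hle (hA.trans_le hcon)) hp inf_le_left
  have h2 := AffineSubspace.eq_of_direction_eq_of_nonempty_of_le
    (Submodule.eq_of_le_of_finrank_le hle' (hB.trans_le hcon)) hp inf_le_right
  exact hne (h1.symm.trans h2)

theorem euclideanHausdorffMeasure_inf_eq_zero {A B : AffineSubspace ℝ (EuclideanSpace ℝ (Fin n))}
    (hA : Module.finrank ℝ A.direction = d) (hB : Module.finrank ℝ B.direction = d)
    (hne : A ≠ B) :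
    (μHE[d] : Measure (EuclideanSpace ℝ (Fin n)))
      (A ⊓ B : AffineSubspace ℝ (EuclideanSpace ℝ (Fin n))) = 0 := by
  rcases ((A ⊓ B : AffineSubspace ℝ (EuclideanSpace ℝ (Fin n))) :
    Set (EuclideanSpace ℝ (Fin n))).eq_empty_or_nonempty with h | h
  · rw [h, measure_empty]
  · exact euclideanHausdorffMeasure_affineSubspace_eq_zero (finrank_direction_inf_lt hA hB hne h)

end NullSets

/-! ### Orientation of images through determinants. -/

section Orientation

variable {d : ℕ} {E : Type*} [AddCommGroup E] [Module ℝ E]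

/-- Subtract the first row from the others and expand along the first column. -/
theorem simplexDet_eq_det_sub (Φ : E →ₗ[ℝ] (Fin d → ℝ)) (g : Fin (d + 1) → E) :
    simplexDet Φ g = Matrix.det (Matrix.of fun i : Fin d => Φ (g i.succ - g 0)) := by
  set B : Matrix (Fin (d + 1)) (Fin (d + 1)) ℝ := Matrix.of
    (Fin.cons (homogCoord Φ (g 0)) fun i => homogCoord Φ (g i.succ) - homogCoord Φ (g 0)) with hB
  have h1 : simplexDet Φ g = B.det := by
    refine Matrix.det_eq_of_forall_row_eq_smul_add_const (Fin.cons 0 fun _ => 1) 0 (by simp) ?_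
    intro i j
    refine Fin.cases ?_ (fun i => ?_) i <;> simp [hB]
  rw [h1, Matrix.det_succ_column_zero, Fin.sum_univ_succ, Finset.sum_eq_zero]
  · simp only [hB, Fin.val_zero, pow_zero, one_mul, Matrix.of_apply, Fin.cons_zero, add_zero]
    rw [show homogCoord Φ (g 0) 0 = 1 from rfl, one_mul]
    congr 1
    ext i j
    simp [homogCoord]
  · intro i _
    simp [hB, homogCoord]

/-- `Φ` restricts to coordinates on the direction space of `τ`, in which `simplexDet` is the
determinant of the edge vectors at `e 0`; `L` maps these to the edge vectors of the image. -/
theorem simplexDet_comp_eq_det_mul [FiniteDimensional ℝ E] {τ : Finset E}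
    (hrank : Module.finrank ℝ (vectorSpan ℝ (τ : Set E)) = d) {Φ : E →ₗ[ℝ] (Fin d → ℝ)}
    (hΦ : ∀ v ∈ vectorSpan ℝ (τ : Set E), Φ v = 0 → v = 0) {e : Fin (d + 1) → E}
    (hr : range e = (τ : Set E)) {f : E → E}
    {L : vectorSpan ℝ (τ : Set E) →ₗ[ℝ] vectorSpan ℝ (τ : Set E)}
    (hL : ∀ u : vectorSpan ℝ (τ : Set E), ∀ v ∈ τ, ∀ w ∈ τ, (u : E) = v - w →
      (L u : E) = f v - f w) :
    simplexDet Φ (f ∘ e) = LinearMap.det L * simplexDet Φ e := by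
  have hmem : ∀ i, e i ∈ τ := fun i => Finset.mem_coe.1 (hr ▸ mem_range_self i)
  have hinj : Function.Injective (Φ ∘ₗ (vectorSpan ℝ (τ : Set E)).subtype) := by
    rw [← LinearMap.ker_eq_bot, LinearMap.ker_eq_bot']
    exact fun v hv => Subtype.ext (hΦ v v.2 hv)
  set Ψ := LinearMap.linearEquivOfInjective (Φ ∘ₗ (vectorSpan ℝ (τ : Set E)).subtype) hinj
    (by rw [hrank]; simp) with hΨ
  have hΨv : ∀ v, Ψ v = Φ v := fun v => rfl
  set b := Module.Basis.ofEquivFun Ψ with hb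
  set u : Fin d → vectorSpan ℝ (τ : Set E) := fun i =>
    ⟨e i.succ - e 0, vsub_mem_vectorSpan ℝ (hmem i.succ) (hmem 0)⟩ with hu
  have hdet : ∀ v : Fin d → vectorSpan ℝ (τ : Set E),
      b.det v = Matrix.det (Matrix.of fun i => Φ (v i)) := by
    intro v
    rw [Module.Basis.det_apply, ← Matrix.det_transpose]
    congr 1
  have h := b.det_comp L u
  rw [hdet, hdet] at h
  rw [simplexDet_eq_det_sub, simplexDet_eq_det_sub]
  rw [← h]
  congr 1
  ext i j
  simp only [Matrix.of_apply, Function.comp_apply]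
  rw [hL (u i) _ (hmem i.succ) _ (hmem 0) rfl]

/-- `L` is the linear part of the map `∑ β v • f v`, with `β v` the barycentric coordinate
functionals of `τ`. -/
theorem exists_linearMap_of_image {τ : Finset E} (hτ : AffineIndependent ℝ ((↑) : τ → E))
    {f : E → E} (hf : ∀ v ∈ τ, f v ∈ affineSpan ℝ (τ : Set E)) :
    ∃ L : vectorSpan ℝ (τ : Set E) →ₗ[ℝ] vectorSpan ℝ (τ : Set E),
      ∀ u : vectorSpan ℝ (τ : Set E), ∀ v ∈ τ, ∀ w ∈ τ, (u : E) = v - w →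
        (L u : E) = f v - f w := by
  classical
  have hex : ∀ v : E, ∃ β : E →ᵃ[ℝ] ℝ, v ∈ τ → β v = 1 ∧ ∀ w ∈ τ, w ≠ v → β w = 0 := by
    intro v
    by_cases hv : v ∈ τ
    · obtain ⟨β, hβ⟩ := exists_coord_functional hτ hv
      exact ⟨β, fun _ => hβ⟩
    · exact ⟨0, fun h => absurd h hv⟩
  choose β hβ using hex
  set L₀ : E →ₗ[ℝ] E := ∑ v ∈ τ, (β v).linear.smulRight (f v) with hL₀
  have hsum : ∀ v ∈ τ, ∑ x ∈ τ, β x v • f x = f v := by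
    intro v hv
    rw [Finset.sum_eq_single v, (hβ v hv).1, one_smul]
    · intro x hx hxv
      rw [(hβ x hx).2 v hv hxv.symm, zero_smul]
    · exact fun h => absurd hv h
  have hL₀' : ∀ v ∈ τ, ∀ w ∈ τ, L₀ (v - w) = f v - f w := by
    intro v hv w hw
    rw [hL₀, LinearMap.sum_apply]
    simp only [LinearMap.smulRight_apply]
    rw [← hsum v hv, ← hsum w hw, ← Finset.sum_sub_distrib]
    refine Finset.sum_congr rfl fun x _ => ?_
    rw [← sub_smul, ← vsub_eq_sub v w, AffineMap.linearMap_vsub, vsub_eq_sub]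
  have hmaps : ∀ u ∈ vectorSpan ℝ (τ : Set E), L₀ u ∈ vectorSpan ℝ (τ : Set E) := by
    have : vectorSpan ℝ (τ : Set E) ≤ (vectorSpan ℝ (τ : Set E)).comap L₀ := by
      conv_lhs => rw [vectorSpan_def]
      rw [Submodule.span_le]
      rintro _ ⟨v, hv, w, hw, rfl⟩
      rw [SetLike.mem_coe, Submodule.mem_comap]
      dsimp only
      rw [vsub_eq_sub, hL₀' v hv w hw, ← direction_affineSpan]
      exact AffineSubspace.vsub_mem_direction (hf v hv) (hf w hw)
    exact fun u hu => this hu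
  refine ⟨L₀.restrict hmaps, fun u v hv w hw huvw => ?_⟩
  rw [LinearMap.coe_restrict_apply, huvw, hL₀' v hv w hw]

open Geometry.SimplicialComplex in
theorem imagePositive_iff_and_imageNegative_iff [FiniteDimensional ℝ E] {τ : Finset E}
    (hτ : AffineIndependent ℝ ((↑) : τ → E))
    (hrank : Module.finrank ℝ (vectorSpan ℝ (τ : Set E)) = d) {Φ : E →ₗ[ℝ] (Fin d → ℝ)}
    (hΦ : ∀ v ∈ vectorSpan ℝ (τ : Set E), Φ v = 0 → v = 0) {e : Fin (d + 1) → E}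
    (hr : range e = (τ : Set E)) {f : E → E} (hf : ∀ v ∈ τ, f v ∈ affineSpan ℝ (τ : Set E))
    (he : simplexDet Φ e ≠ 0) :
    (ImagePositive τ f ↔ 0 < simplexDet Φ e * simplexDet Φ (f ∘ e)) ∧
      (ImageNegative τ f ↔ simplexDet Φ e * simplexDet Φ (f ∘ e) < 0) := by
  obtain ⟨L, hL⟩ := exists_linearMap_of_image hτ hf
  have hdet : ∀ L : vectorSpan ℝ (τ : Set E) →ₗ[ℝ] vectorSpan ℝ (τ : Set E),
      (∀ u : vectorSpan ℝ (τ : Set E), ∀ v ∈ τ, ∀ w ∈ τ, (u : E) = v - w →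
        (L u : E) = f v - f w) →
      simplexDet Φ e * simplexDet Φ (f ∘ e) = LinearMap.det L * simplexDet Φ e ^ 2 := by
    intro L hL
    rw [simplexDet_comp_eq_det_mul hrank hΦ hr hL]
    ring
  have hpos : 0 < simplexDet Φ e ^ 2 := sq_pos_of_ne_zero he
  refine ⟨⟨?_, fun h => ⟨hf, L, hL, ?_⟩⟩, ⟨?_, fun h => ⟨hf, L, hL, ?_⟩⟩⟩
  · rintro ⟨-, L, hL, h⟩
    rw [hdet L hL]
    exact mul_pos h hpos
  · rw [hdet L hL] at h
    exact pos_of_mul_pos_left h hpos.le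
  · rintro ⟨-, L, hL, h⟩
    rw [hdet L hL]
    exact mul_neg_of_neg_of_pos h hpos
  · rw [hdet L hL] at h
    exact neg_of_mul_neg_left h hpos.le

end Orientation

/-! ### The homotopy on a single simplex. -/

namespace Geometry.SimplicialComplex

variable {E : Type*} [AddCommGroup E] [Module ℝ E] (T : SimplicialComplex ℝ E)

theorem vertexHomotopy_eq_sum {γ : E → I → E} {t : I} {τ : Finset E} (hτ : τ ∈ T.faces)
    {c : E → ℝ} (hc0 : ∀ v ∈ τ, 0 ≤ c v) (hc1 : ∑ v ∈ τ, c v = 1) :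
    T.vertexHomotopy γ t (∑ v ∈ τ, c v • v) = ∑ v ∈ τ, c v • γ v t := by
  classical
  have hx : ∑ v ∈ τ, c v • v ∈ convexHull ℝ (τ : Set E) :=
    Finset.mem_convexHull'.2 ⟨c, hc0, hc1, rfl⟩
  obtain ⟨w, hw, hsupp⟩ := exists_isBarycentric hτ hx
  have hw1 : ∑ v ∈ τ, w v = 1 := by
    rw [← hw.2.2.1, Finsupp.sum_of_support_subset _ hsupp _ (by simp)]
  have hwx : ∑ v ∈ τ, w v • v = ∑ v ∈ τ, c v • v := by
    rw [← hw.2.2.2, Finsupp.sum_of_support_subset _ hsupp _ (by simp)]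
  have hwc : ∀ v ∈ τ, w v = c v := by
    intro v hv
    obtain ⟨β, hβv, hβ⟩ := exists_coord_functional (T.indep hτ) hv
    have hcoord : ∀ a : E → ℝ, ∑ x ∈ τ, a x = 1 → β (∑ x ∈ τ, a x • x) = a v := by
      intro a ha
      rw [AffineMap.map_sum_smul β _ ha, Finset.sum_eq_single v, hβv]
      · simp
      · intro x hx hxv
        rw [hβ x hx hxv, smul_zero]
      · exact fun h => absurd hv h
    rw [← hcoord w hw1, hwx, hcoord c hc1]
  rw [vertexHomotopy, hw.barycentric_eq, Finsupp.sum_of_support_subset _ hsupp _ (by simp)]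
  exact Finset.sum_congr rfl fun v hv => by rw [hwc v hv]

theorem vertexHomotopy_vertex {γ : E → I → E} {t : I} {v : E} (hv : v ∈ T.vertices) :
    T.vertexHomotopy γ t v = γ v t := by
  have := T.vertexHomotopy_eq_sum (γ := γ) (t := t) hv (c := fun _ => 1) (by simp) (by simp)
  simpa using this

theorem vertexHomotopy_image_convexHull {γ : E → I → E} {t : I} {τ : Finset E}
    (hτ : τ ∈ T.faces) : T.vertexHomotopy γ t '' convexHull ℝ (τ : Set E) =
      convexHull ℝ (T.vertexHomotopy γ t '' (τ : Set E)) := by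
  have hvert : ∀ v ∈ τ, T.vertexHomotopy γ t v = γ v t := fun v hv =>
    T.vertexHomotopy_vertex
      (T.down_closed hτ (Finset.singleton_subset_iff.2 hv) (Finset.singleton_nonempty v))
  have hrange : T.vertexHomotopy γ t '' (τ : Set E) = range fun v : τ => γ v t := by
    ext z
    constructor
    · rintro ⟨v, hv, rfl⟩
      exact ⟨⟨v, hv⟩, (hvert v hv).symm⟩
    · rintro ⟨v, rfl⟩
      exact ⟨v, v.2, hvert v v.2⟩
  classical
  ext z
  rw [hrange, mem_convexHull_range_iff]
  constructor
  · rintro ⟨x, hx, rfl⟩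
    obtain ⟨c, hc0, hc1, rfl⟩ := Finset.mem_convexHull'.1 hx
    refine ⟨fun v => c v, fun v => hc0 v v.2, ?_, ?_⟩
    · rw [Finset.sum_coe_sort, hc1]
    · rw [T.vertexHomotopy_eq_sum hτ hc0 hc1, Finset.sum_coe_sort τ fun v => c v • γ v t]
  · rintro ⟨c, hc0, hc1, rfl⟩
    set c' : E → ℝ := fun v => if h : v ∈ τ then c ⟨v, h⟩ else 0 with hc'
    have hval : ∀ v : τ, c' v = c v := fun v => by simp [hc']
    have hc0' : ∀ v ∈ τ, 0 ≤ c' v := fun v hv => (hval ⟨v, hv⟩).symm ▸ hc0 _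
    have hc1' : ∑ v ∈ τ, c' v = 1 := by
      rw [← Finset.sum_coe_sort, ← hc1]
      exact Finset.sum_congr rfl fun v _ => hval v
    refine ⟨∑ v ∈ τ, c' v • v, Finset.mem_convexHull'.2 ⟨c', hc0', hc1', rfl⟩, ?_⟩
    rw [T.vertexHomotopy_eq_sum hτ hc0' hc1', ← Finset.sum_coe_sort]
    exact Finset.sum_congr rfl fun v _ => by rw [hval v]

end Geometry.SimplicialComplex

theorem Polytope.isClosed_space {d n : ℕ} (P : Polytope d n) : IsClosed P.space :=
  P.cells.finite_toSet.isClosed_biUnion fun V _ => V.finite_toSet.isClosed_convexHull ℝ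

theorem Polytope.mem_minimalCell {d n : ℕ} (P : Polytope d n) (x : EuclideanSpace ℝ (Fin n)) :
    x ∈ P.minimalCell x :=
  mem_iInter₂.2 fun _ hV => hV.2

open Classical in
theorem movedSign_eq_ite {d : ℕ} {E : Type*} [AddCommGroup E] [Module ℝ E]
    (Φ : E →ₗ[ℝ] (Fin d → ℝ)) (y : E) {τ : Finset E} (g : E → E)
    {e : Fin (d + 1) → E} (he : Function.Injective e) (hr : range e = (τ : Set E)) :
    movedSign Φ y τ g = if y ∈ convexHull ℝ (g '' τ) then
      (SignType.sign (simplexDet Φ e * simplexDet Φ (g ∘ e)) : ℤ) else 0 := by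
  rw [movedSign_eq Φ y g he hr, coverSign, range_comp, hr, sign_mul, SignType.coe_mul, ← mul_assoc]
  split_ifs <;> simp

theorem exists_linearMap_injective_on {d : ℕ} {E : Type*} [AddCommGroup E] [Module ℝ E]
    [FiniteDimensional ℝ E] {U : Submodule ℝ E} (hU : Module.finrank ℝ U = d) :
    ∃ Φ : E →ₗ[ℝ] (Fin d → ℝ), ∀ v ∈ U, Φ v = 0 → v = 0 := by
  let Ψ : U ≃ₗ[ℝ] (Fin d → ℝ) := LinearEquiv.ofFinrankEq _ _ (by simp [hU])
  obtain ⟨Φ, hΦ⟩ := LinearMap.exists_extend (Ψ : U →ₗ[ℝ] (Fin d → ℝ))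
  refine ⟨Φ, fun v hv h => ?_⟩
  have h1 : Ψ ⟨v, hv⟩ = 0 := by
    rw [← h]
    exact (LinearMap.congr_fun hΦ ⟨v, hv⟩).symm
  exact congrArg Subtype.val ((LinearEquiv.map_eq_zero_iff Ψ).1 h1)

/-! ### The signed count before and after the motion. -/

namespace Polytope.IsTriangulation

variable {d n : ℕ} {P : Polytope d n}
  {T : Geometry.SimplicialComplex ℝ (EuclideanSpace ℝ (Fin n))}

theorem finite_vertices (hT : P.IsTriangulation T) : T.vertices.Finite :=
  hT.finite.preimage Finset.singleton_injective.injOn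

/-- Induction on the set of vertices already moved. `Q` contains all initial and final positions, so
the same `y` is generic at every stage. -/
theorem sum_movedSign_eq_sum_movedSign_id (hT : P.IsTriangulation T)
    {Q : Set (EuclideanSpace ℝ (Fin n))} {y : EuclideanSpace ℝ (Fin n)}
    (hyQ : InGeneralPosition d Q y) {A : AffineSubspace ℝ (EuclideanSpace ℝ (Fin n))}
    {Φ : EuclideanSpace ℝ (Fin n) →ₗ[ℝ] (Fin d → ℝ)}
    (hΦ : ∀ v ∈ A.direction, Φ v = 0 → v = 0) (hy : y ∈ A)
    {S : Finset (Finset (EuclideanSpace ℝ (Fin n)))}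
    (hS : ∀ τ, τ ∈ S ↔ τ ∈ T.faces ∧ τ.card = d + 1 ∧
      affineSpan ℝ (τ : Set (EuclideanSpace ℝ (Fin n))) = A)
    {f : EuclideanSpace ℝ (Fin n) → EuclideanSpace ℝ (Fin n)}
    (hf : ∀ x ∈ T.vertices, f x ∈ affineSpan ℝ (P.minimalCell x))
    (hfQ : ∀ x ∈ T.vertices, f x ∈ Q) (hQ : T.vertices ⊆ Q) :
    ∑ τ ∈ S, movedSign Φ y τ f = ∑ τ ∈ S, movedSign Φ y τ id := by
  classical
  have key : ∀ U : Finset (EuclideanSpace ℝ (Fin n)), (U : Set (EuclideanSpace ℝ (Fin n))) ⊆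
      T.vertices → ∑ τ ∈ S, movedSign Φ y τ (fun x => if x ∈ U then f x else x) =
        ∑ τ ∈ S, movedSign Φ y τ id := by
    intro U
    induction U using Finset.induction_on with
    | empty =>
      intro _
      simp only [Finset.notMem_empty, if_false]
      rfl
    | insert v U hvU ih =>
      intro hU
      rw [Finset.coe_insert, insert_subset_iff] at hU
      have hupd : (fun x => if x ∈ insert v U then f x else x) =
          Function.update (fun x => if x ∈ U then f x else x) v (f v) := by
        funext x
        by_cases hx : x = v
        · subst hx
          simp
        · simp [hx]
      rw [hupd, hT.sum_movedSign_update hyQ hΦ hy hS ?_ ?_ (hf v hU.1) (hfQ v hU.1), ih hU.2]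
      · intro x hx
        split_ifs
        · exact hf x hx
        · exact subset_affineSpan ℝ _ (P.mem_minimalCell x)
      · intro x hx
        split_ifs
        · exact hfQ x hx
        · exact hQ hx
  rw [← key hT.finite_vertices.toFinset (by simp)]
  refine Finset.sum_congr rfl fun τ hτ => movedSign_congr Φ y fun v hv => ?_
  rw [if_pos (hT.finite_vertices.mem_toFinset.2 (T.down_closed ((hS τ).1 hτ).1
    (Finset.singleton_subset_iff.2 hv) (Finset.singleton_nonempty v)))]

/-- Unmoved simplices carry the sign of a square. A second simplex through `y` would meet `τ₀` in a
face with at most `d` vertices, which general position excludes. -/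
theorem sum_movedSign_id {Q : Set (EuclideanSpace ℝ (Fin n))} {y : EuclideanSpace ℝ (Fin n)}
    (hyQ : InGeneralPosition d Q y) {A : AffineSubspace ℝ (EuclideanSpace ℝ (Fin n))}
    {Φ : EuclideanSpace ℝ (Fin n) →ₗ[ℝ] (Fin d → ℝ)}
    (hΦ : ∀ v ∈ A.direction, Φ v = 0 → v = 0)
    {S : Finset (Finset (EuclideanSpace ℝ (Fin n)))}
    (hS : ∀ τ, τ ∈ S ↔ τ ∈ T.faces ∧ τ.card = d + 1 ∧
      affineSpan ℝ (τ : Set (EuclideanSpace ℝ (Fin n))) = A) (hQ : T.vertices ⊆ Q)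
    {τ₀ : Finset (EuclideanSpace ℝ (Fin n))} (hτ₀ : τ₀ ∈ S)
    (hyτ₀ : y ∈ convexHull ℝ (τ₀ : Set (EuclideanSpace ℝ (Fin n)))) :
    ∑ τ ∈ S, movedSign Φ y τ id = 1 := by
  classical
  have hterm : ∀ τ ∈ S, movedSign Φ y τ id =
      if y ∈ convexHull ℝ (τ : Set (EuclideanSpace ℝ (Fin n))) then 1 else 0 := by
    intro τ hτS
    obtain ⟨hτ, hcard, hA⟩ := (hS τ).1 hτS
    obtain ⟨e, he, hr⟩ := exists_enumeration hcard
    have hind : AffineIndependent ℝ e := by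
      have h1 := (T.indep hτ).comp_embedding
        ⟨fun i => (⟨e i, Finset.mem_coe.1 (hr ▸ mem_range_self i)⟩ : τ), fun i j h =>
          he (congrArg Subtype.val h)⟩
      exact h1
    have hdet := simplexDet_ne_zero hΦ (g := e) (fun i => by
      rw [← hA, ← hr]
      exact subset_affineSpan ℝ _ (mem_range_self i)) hind
    rw [movedSign_eq_ite Φ y id he hr, image_id, Function.id_comp,
      sign_pos (mul_self_pos.2 hdet)]
    rfl
  obtain ⟨hτ₀f, hcard₀, -⟩ := (hS τ₀).1 hτ₀
  rw [Finset.sum_congr rfl hterm, Finset.sum_eq_single τ₀, if_pos hyτ₀]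
  · intro τ hτS hne
    rw [if_neg]
    intro hyτ
    obtain ⟨hτ, hcard, -⟩ := (hS τ).1 hτS
    have h1 := convexHull_subset_affineSpan _ (T.inter_subset_convexHull hτ hτ₀f ⟨hyτ, hyτ₀⟩)
    rw [← Finset.coe_inter] at h1
    refine hyQ (τ ∩ τ₀) ?_ ?_ h1
    · intro x hx
      exact hQ (T.down_closed hτ (Finset.singleton_subset_iff.2
        (Finset.mem_inter.1 (Finset.mem_coe.1 hx)).1) (Finset.singleton_nonempty x))
    · by_contra hlt
      rw [not_le] at hlt
      have e1 := Finset.eq_of_subset_of_card_le (Finset.inter_subset_left (s₁ := τ) (s₂ := τ₀))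
        (by omega)
      have e2 := Finset.eq_of_subset_of_card_le (Finset.inter_subset_right (s₁ := τ) (s₂ := τ₀))
        (by omega)
      exact hne (e1.symm.trans e2)
  · exact fun h => absurd hτ₀ h

theorem ae_notMem_inf (hT : P.IsTriangulation T) :
    ∀ᵐ y ∂(μHE[d] : Measure (EuclideanSpace ℝ (Fin n))), ∀ τ ∈ T.faces, ∀ τ' ∈ T.faces,
      τ.card = d + 1 → τ'.card = d + 1 →
      y ∈ affineSpan ℝ (τ : Set (EuclideanSpace ℝ (Fin n))) →
      y ∈ affineSpan ℝ (τ' : Set (EuclideanSpace ℝ (Fin n))) →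
      affineSpan ℝ (τ : Set (EuclideanSpace ℝ (Fin n))) =
        affineSpan ℝ (τ' : Set (EuclideanSpace ℝ (Fin n))) := by
  rw [ae_ball_iff hT.finite.countable]
  intro τ hτ
  rw [ae_ball_iff hT.finite.countable]
  intro τ' hτ'
  by_cases hcard : τ.card = d + 1 ∧ τ'.card = d + 1
  · by_cases heq : affineSpan ℝ (τ : Set (EuclideanSpace ℝ (Fin n))) =
        affineSpan ℝ (τ' : Set (EuclideanSpace ℝ (Fin n)))
    · exact Filter.Eventually.of_forall fun _ _ _ _ _ => heq
    · have hnull := euclideanHausdorffMeasure_inf_eq_zero (d := d)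
        (by rw [direction_affineSpan]; exact finrank_eq hτ hcard.1)
        (by rw [direction_affineSpan]; exact finrank_eq hτ' hcard.2) heq
      filter_upwards [measure_eq_zero_iff_ae_notMem.1 hnull] with y hy _ _ h1 h2
      exact absurd ⟨h1, h2⟩ hy
  · exact Filter.Eventually.of_forall fun _ h1 h2 => absurd ⟨h1, h2⟩ hcard

end Polytope.IsTriangulation

/-! ### The odd-covering theorem. -/

theorem mainTheorem6 {d n : ℕ} (P : Polytope d n)
    (T : Geometry.SimplicialComplex ℝ (EuclideanSpace ℝ (Fin n))) (hT : P.IsTriangulation T)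
    (γ : EuclideanSpace ℝ (Fin n) → I → EuclideanSpace ℝ (Fin n))
    (hγ_cont : ∀ v ∈ T.vertices, Continuous (γ v))
    (hγ_mem : ∀ v ∈ T.vertices, ∀ t : I, γ v t ∈ affineSpan ℝ (P.minimalCell v))
    (hγ_zero : ∀ v ∈ T.vertices, γ v 0 = v) :
    ∀ᵐ x ∂(μHE[d]).restrict P.space,
      Odd (T.covering d (T.vertexHomotopy γ 1) x).ncard ∧
      {τ ∈ T.covering d (T.vertexHomotopy γ 1) x |
          Geometry.SimplicialComplex.ImagePositive τ (T.vertexHomotopy γ 1)}.ncard =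
        {τ ∈ T.covering d (T.vertexHomotopy γ 1) x |
          Geometry.SimplicialComplex.ImageNegative τ (T.vertexHomotopy γ 1)}.ncard + 1 := by
  classical
  set f := T.vertexHomotopy γ 1 with hf
  have hvert : ∀ {τ x}, τ ∈ T.faces → x ∈ τ → x ∈ T.vertices := fun hτ hx =>
    T.down_closed hτ (Finset.singleton_subset_iff.2 hx) (Finset.singleton_nonempty _)
  have hf_mem : ∀ x ∈ T.vertices, f x ∈ affineSpan ℝ (P.minimalCell x) := fun x hx => by
    rw [hf, T.vertexHomotopy_vertex hx]
    exact hγ_mem x hx 1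
  set Q : Set (EuclideanSpace ℝ (Fin n)) := T.vertices ∪ f '' T.vertices with hQ
  have hQfin : Q.Finite := hT.finite_vertices.union (hT.finite_vertices.image f)
  rw [ae_restrict_iff' P.isClosed_space.measurableSet]
  filter_upwards [ae_inGeneralPosition (d := d) hQfin, hT.ae_notMem_inf] with y hyQ hyinf hyP
  have hyT : y ∈ T.space := hT.space_eq ▸ hyP
  obtain ⟨τ₀, hτ₀, hyτ₀⟩ := Geometry.SimplicialComplex.mem_space_iff.1 hyT
  have hcard₀ : τ₀.card = d + 1 := by
    refine le_antisymm (hT.card_le hτ₀) (Nat.lt_iff_add_one_le.1 (not_le.1 fun h => ?_))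
    exact hyQ τ₀ (fun x hx => Or.inl (hvert hτ₀ hx)) h (convexHull_subset_affineSpan _ hyτ₀)
  set A := affineSpan ℝ (τ₀ : Set (EuclideanSpace ℝ (Fin n))) with hA
  have hyA : y ∈ A := convexHull_subset_affineSpan _ hyτ₀
  have hrankA : Module.finrank ℝ A.direction = d := by
    rw [hA, direction_affineSpan]
    exact Polytope.IsTriangulation.finrank_eq hτ₀ hcard₀
  obtain ⟨Φ, hΦ⟩ := exists_linearMap_injective_on hrankA
  obtain ⟨S, hS⟩ : ∃ S : Finset (Finset (EuclideanSpace ℝ (Fin n))), ∀ τ, τ ∈ S ↔ τ ∈ T.faces ∧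
      τ.card = d + 1 ∧ affineSpan ℝ (τ : Set (EuclideanSpace ℝ (Fin n))) = A :=
    ⟨hT.finite.toFinset.filter fun τ : Finset (EuclideanSpace ℝ (Fin n)) => τ.card = d + 1 ∧
      affineSpan ℝ (τ : Set (EuclideanSpace ℝ (Fin n))) = A, fun τ => by
        rw [Finset.mem_filter, hT.finite.mem_toFinset]⟩
  have hsum : ∑ τ ∈ S, movedSign Φ y τ f = 1 := by
    rw [hT.sum_movedSign_eq_sum_movedSign_id hyQ hΦ hyA hS hf_mem
      (fun x hx => Or.inr (mem_image_of_mem f hx)) subset_union_left]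
    exact Polytope.IsTriangulation.sum_movedSign_id hyQ hΦ hS subset_union_left
      ((hS τ₀).2 ⟨hτ₀, hcard₀, rfl⟩) hyτ₀
  have hfspan : ∀ {τ}, τ ∈ T.faces → τ.card = d + 1 → ∀ v ∈ τ,
      f v ∈ affineSpan ℝ (τ : Set (EuclideanSpace ℝ (Fin n))) := fun hτ hcard v hv =>
    hT.affineSpan_minimalCell_le hτ hcard hv (hf_mem v (hvert hτ hv))
  -- A simplex whose image contains `y` has `y` in its own affine span, which must then be `A`; so
  -- counting over `S` loses nothing.
  have hcov : T.covering d f y =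
      ((S.filter fun τ : Finset (EuclideanSpace ℝ (Fin n)) => y ∈ convexHull ℝ (f '' (τ : Set (EuclideanSpace ℝ (Fin n)))) :
        Finset _) : Set (Finset (EuclideanSpace ℝ (Fin n)))) := by
    ext τ
    rw [Finset.mem_coe, Finset.mem_filter, hS]
    constructor
    · rintro ⟨hτ, hcard, hy⟩
      rw [hf, T.vertexHomotopy_image_convexHull hτ, ← hf] at hy
      refine ⟨⟨hτ, hcard, hyinf τ hτ τ₀ hτ₀ hcard hcard₀ ?_ hyA⟩, hy⟩
      refine convexHull_min ?_ (AffineSubspace.convex _) hy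
      rintro _ ⟨v, hv, rfl⟩
      exact hfspan hτ hcard v hv
    · rintro ⟨⟨hτ, hcard, -⟩, hy⟩
      refine ⟨hτ, hcard, ?_⟩
      rwa [hf, T.vertexHomotopy_image_convexHull hτ, ← hf]
  have hsep : ∀ p : Finset (EuclideanSpace ℝ (Fin n)) → Prop, {τ ∈ T.covering d f y | p τ} =
      ((S.filter fun τ : Finset (EuclideanSpace ℝ (Fin n)) => y ∈ convexHull ℝ (f '' (τ : Set (EuclideanSpace ℝ (Fin n)))) ∧ p τ :
        Finset _) : Set (Finset (EuclideanSpace ℝ (Fin n)))) := by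
    intro p
    ext τ
    rw [mem_ofPred_eq, hcov, Finset.mem_coe, Finset.mem_coe, Finset.mem_filter, Finset.mem_filter,
      and_assoc]
  have hterm : ∀ τ ∈ S,
      (movedSign Φ y τ f =
        (if y ∈ convexHull ℝ (f '' (τ : Set (EuclideanSpace ℝ (Fin n)))) ∧
          Geometry.SimplicialComplex.ImagePositive τ f then 1 else 0) -
        if y ∈ convexHull ℝ (f '' (τ : Set (EuclideanSpace ℝ (Fin n)))) ∧
          Geometry.SimplicialComplex.ImageNegative τ f then 1 else 0) ∧
      (if y ∈ convexHull ℝ (f '' (τ : Set (EuclideanSpace ℝ (Fin n)))) then (1 : ℤ) else 0) =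
        (if y ∈ convexHull ℝ (f '' (τ : Set (EuclideanSpace ℝ (Fin n)))) ∧
          Geometry.SimplicialComplex.ImagePositive τ f then 1 else 0) +
        if y ∈ convexHull ℝ (f '' (τ : Set (EuclideanSpace ℝ (Fin n)))) ∧
          Geometry.SimplicialComplex.ImageNegative τ f then 1 else 0 := by
    intro τ hτS
    obtain ⟨hτ, hcard, hτA⟩ := (hS τ).1 hτS
    obtain ⟨e, he, hr⟩ := exists_enumeration hcard
    have hmem : ∀ i, e i ∈ τ := fun i => Finset.mem_coe.1 (hr ▸ mem_range_self i)
    rw [movedSign_eq_ite Φ y f he hr]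
    by_cases hy : y ∈ convexHull ℝ (f '' (τ : Set (EuclideanSpace ℝ (Fin n))))
    · have hind : AffineIndependent ℝ e := (T.indep hτ).comp_embedding
        ⟨fun i => (⟨e i, hmem i⟩ : τ), fun i j h => he (congrArg Subtype.val h)⟩
      have hdet := simplexDet_ne_zero hΦ (g := e)
        (fun i => hτA ▸ subset_affineSpan ℝ _ (Finset.mem_coe.2 (hmem i))) hind
      have hdet' := simplexDet_ne_zero_of_mem_convexHull hyQ hΦ (g := f ∘ e)
        (fun i => hτA ▸ hfspan hτ hcard _ (hmem i))
        (fun i => Or.inr (mem_image_of_mem f (hvert hτ (hmem i))))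
        (by rwa [range_comp, hr])
      obtain ⟨hpos, hneg⟩ := imagePositive_iff_and_imageNegative_iff (T.indep hτ)
        (Polytope.IsTriangulation.finrank_eq hτ hcard)
        (Φ := Φ) (by rw [← direction_affineSpan, hτA]; exact hΦ) hr (hfspan hτ hcard) hdet
      simp only [hy, true_and, if_true, hpos, hneg]
      rcases lt_or_gt_of_ne (mul_ne_zero hdet hdet') with h | h
      · simp [h, h.not_gt, sign_neg h]
      · simp [h, h.not_gt, sign_pos h]
    · simp [hy]
  -- `h1` becomes positive minus negative equals 1, and `h2` total equals positive plus negative; so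
  -- the total is twice the negative count plus 1.
  have h1 := Finset.sum_congr rfl fun τ hτ => (hterm τ hτ).1
  have h2 := Finset.sum_congr rfl fun τ hτ => (hterm τ hτ).2
  rw [hsum, Finset.sum_sub_distrib] at h1
  rw [Finset.sum_add_distrib] at h2
  simp only [Finset.sum_boole] at h1 h2
  rw [hsep, hsep, hcov, ncard_coe_finset, ncard_coe_finset, ncard_coe_finset]
  refine ⟨?_, by omega⟩
  rw [Nat.odd_iff]
  omega
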